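/- For points $a^1,\dots,a^m\in\mathbb R^d$ and centers $c^1,\dots,c^k\in\mathbb R^d$ let $\operatorname{cost}(c^1,\dots,c^k)=\sum_{i=1}^m\min_{1\le j\le k}\|a^i-c^j\|_2^2$, and let $\mathsf{OPT}$ be the infimum (attained) of the cost over all choices of $k$ centers. Theorem. There are absolute constants $c,C>0$ and $a,b\in\mathbb N$ such that the following holds for all $0<\varepsilon<1$, $k\ge 2$, $d\ge 1/\varepsilon$, $n\ge Ck/\varepsilon$ and $\Delta\ge(dk/\varepsilon)^{b}$. Consider a (possibly randomized) one-pass streaming algorithm in the row-arrival model: the input points arrive one at a time, and between arrivals the algorithm keeps only $s$ bits of memory (its random coins and the number of points read so far are available free of charge). Suppose that, for every stream of at most $n$ points of $\mathbb R^d$ all of whose coordinates are integers of absolute value at most $\Delta$, the algorithm outputs after one pass, with probability at least $2/3$, centers $\hat c^1,\dots,\hat c^k\in\mathbb R^d$ with $\operatorname{cost}(\hat c^1,\dots,\hat c^k)\le(1+\varepsilon)\,\mathsf{OPT}$. Then $$ s\;\ge\; c\cdot\frac{dk/\varepsilon}{\log^{a}(dk/\varepsilon)} ,$$ that is, the algorithm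 must use $\tilde\Omega(dk/\varepsilon)$ bits of space. -/

import Mathlib

open MeasureTheory

noncomputable section

namespace KMeansStream

/-- The `k`-means cost of the centers `c 0, …, c (k-1)` on the points listed in `pts`:
the sum over the points of the squared Euclidean distance to the nearest center. -/
def cost {d k : ℕ} (pts : List (EuclideanSpace ℝ (Fin d)))
    (c : Fin k → EuclideanSpace ℝ (Fin d)) : ℝ :=
  (pts.map fun a => ⨅ j : Fin k, ‖a - c j‖ ^ 2).sum

/-- The optimal `k`-means cost of the points listed in `pts`. -/
def opt {d : ℕ} (k : ℕ) (pts : List (EuclideanSpace ℝ (Fin d))) : ℝ :=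
  ⨅ c : Fin k → EuclideanSpace ℝ (Fin d), cost pts c

/-- The centers `c` are a `(1 + ε)`-approximately optimal solution of the `k`-means problem. -/
def IsApproxOptimal {d k : ℕ} (ε : ℝ) (pts : List (EuclideanSpace ℝ (Fin d)))
    (c : Fin k → EuclideanSpace ℝ (Fin d)) : Prop :=
  cost pts c ≤ (1 + ε) * opt k pts

/-- A one-pass row-arrival streaming algorithm with `s` bits of memory which outputs `k` centers
in `ℝ^d`. The rows arrive one at a time; the only thing kept from one arrival to the next is the
memory, a string of `s` bits. The random seed `ω : Ω` (which may consist of fresh coins for every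
step) and the number of rows read so far are available at no cost, and neither the computation
performed at an arrival nor the one that produces the output is restricted. A deterministic
algorithm is one that ignores `ω`. -/
structure RowArrivalAlgorithm (Ω : Type*) (d k s : ℕ) where
  /-- the memory before the first row -/
  init : Ω → (Fin s → Bool)
  /-- the new memory, from the seed, the number of earlier rows, the memory and the new row -/
  update : Ω → ℕ → (Fin s → Bool) → EuclideanSpace ℝ (Fin d) → (Fin s → Bool)
  /-- the centers, from the seed, the number of rows and the final memory -/
  output : Ω → ℕ → (Fin s → Bool) → (Fin k → EuclideanSpace ℝ (Fin d))

namespace RowArrivalAlgorithm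

variable {Ω : Type*} {d k s : ℕ}

/-- The memory after the listed rows have arrived, starting from the memory `σ` after `t` rows. -/
def runFrom (A : RowArrivalAlgorithm Ω d k s) (ω : Ω) :
    ℕ → (Fin s → Bool) → List (EuclideanSpace ℝ (Fin d)) → (Fin s → Bool)
  | _, σ, [] => σ
  | t, σ, a :: rows => A.runFrom ω (t + 1) (A.update ω t σ a) rows

/-- The centers which the algorithm outputs after one pass through the stream. -/
def centers (A : RowArrivalAlgorithm Ω d k s) (ω : Ω)
    (stream : List (EuclideanSpace ℝ (Fin d))) : Fin k → EuclideanSpace ℝ (Fin d) :=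
  A.output ω stream.length (A.runFrom ω 0 (A.init ω) stream)

/-- On this stream the algorithm outputs `(1 + ε)`-approximately optimal centers with
probability at least `2/3`. (The event is taken as a measurable set, so that no measurability has
to be asked of the algorithm itself.) -/
def SucceedsOn [MeasurableSpace Ω] (A : RowArrivalAlgorithm Ω d k s) (μ : Measure Ω) (ε : ℝ)
    (stream : List (EuclideanSpace ℝ (Fin d))) : Prop :=
  ∃ E : Set Ω, MeasurableSet E ∧ (∀ ω ∈ E, IsApproxOptimal ε stream (A.centers ω stream)) ∧
    2 / 3 ≤ μ E

end RowArrivalAlgorithm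

/-- All entries of all rows are integers of absolute value at most `Δ`. -/
def HasIntegerEntries {d : ℕ} (Δ : ℕ) (stream : List (EuclideanSpace ℝ (Fin d))) : Prop :=
  ∀ a ∈ stream, ∀ j : Fin d, ∃ z : ℤ, |z| ≤ (Δ : ℤ) ∧ a j = (z : ℝ)

end KMeansStream

end

/-! The bound is a one-way communication argument. For `ε ≤ 1/20000` take `r ≈ 1/(20000 ε)`, about
`k/2` groups and `D` of order `d`. The first part of the stream puts into each group, for `j < r`,
the point `(R e_j, b_j)` with `b_j` a sign vector of length `D`. It carries about `kD/ε` bits, up to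
constants. A query `i` appends, in each group, two copies of `p = (R e_i, 0)` and many copies of the
origin. The planted clustering of a group is `{a_i, p, p}` versus the rest; its first center is `(R
e_i, b_i/3)`, whose signs reveal `b_i`. One planted group costs `O(rD)`, so the allowed excess `ε ·
OPT` is only a small multiple of `D` per group on average. Widely spaced offsets keep a center from
serving two groups.

Stability is the crux (`group_stability`). Centers may be distributed unevenly among the groups, so
each is charged a price `lam = R² + 8D`. This is the most one center can save over serving its code
points from the origin, provided `‖∑_{j ∈ S} a_j‖² ≤ lam |S|` for every `S`. A Chernoff and union
bound gives this property to at least half of the sign matrices (`half_le_card_shortSums`). The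
budget of two centers per group then makes the prices cancel in the sum. A group with misplaced
centers loses at least `D`; otherwise the excess controls the distance from the center of `p` to the
planted mean. Hence few decoded bits are wrong (`card_decodeRows_ne_le`), and counting strings by
agreements (`le_of_decode`) bounds the memory.

For larger `ε` it suffices to show `s ≥ c·kd`: on `k` distinct points `OPT = 0`, so the output must
reproduce all their coordinates. -/

noncomputable section

namespace KMeansStream

/-! ### Counting bound for approximate decoding from `s` bits. -/

section Information

/-- Summed over all bit strings `x`, two to the number of agreements of `x` with `y` is `3 ^ N`. -/
lemma sum_two_pow_agree {ι : Type*} [Fintype ι] [DecidableEq ι] (y : ι → Bool) :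
    ∑ x : ι → Bool, (2 : ℝ) ^ (Finset.univ.filter fun l => y l = x l).card
      = 3 ^ Fintype.card ι := by
  have h : ∀ x : ι → Bool, (2 : ℝ) ^ (Finset.univ.filter fun l => y l = x l).card
      = ∏ l, if y l = x l then (2 : ℝ) else 1 := by
    intro x
    rw [Finset.prod_ite]
    simp
  simp_rw [h]
  have := Finset.prod_univ_sum (fun _ : ι => (Finset.univ : Finset Bool))
    (fun l b => if y l = b then (2 : ℝ) else 1)
  rw [Fintype.piFinset_univ] at this
  rw [← this]
  have h3 : ∀ l, ∑ b : Bool, (if y l = b then (2 : ℝ) else 1) = 3 := by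
    intro l
    cases y l <;> norm_num
  simp_rw [h3]
  simp

/-- If `s` bits suffice to agree with the average string from `M` in 65% of the positions, then
`M` is small. -/
lemma card_mul_le_of_agree {ι : Type*} [Fintype ι] [DecidableEq ι] {s : ℕ}
    (M : Finset (ι → Bool)) (mem : (ι → Bool) → (Fin s → Bool))
    (dec : (Fin s → Bool) → ι → Bool)
    (h : 0.65 * (Fintype.card ι : ℝ) * M.card
      ≤ ∑ x ∈ M, ((Finset.univ.filter fun l => dec (mem x) l = x l).card : ℝ)) :
    (M.card : ℝ) * (2 : ℝ) ^ (0.65 * (Fintype.card ι : ℝ)) ≤ 2 ^ s * 3 ^ Fintype.card ι := by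
  set T : ℝ := 0.65 * (Fintype.card ι : ℝ) with hT
  have hlog : 0 < Real.log 2 := Real.log_pos (by norm_num)
  -- Tangent line of the convex function `2 ^ n` at `T`: Jensen's inequality in a form that can be
  -- summed over `M`.
  have h2 : ∀ n : ℕ, (2 : ℝ) ^ T * (1 + ((n : ℝ) - T) * Real.log 2) ≤ 2 ^ n := by
    intro n
    have e : (2 : ℝ) ^ n = (2 : ℝ) ^ T * (2 : ℝ) ^ ((n : ℝ) - T) := by
      rw [← Real.rpow_add (by norm_num), ← Real.rpow_natCast]
      congr 1
      ring
    rw [e]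
    refine mul_le_mul_of_nonneg_left ?_ (by positivity)
    rw [Real.rpow_def_of_pos (by norm_num)]
    have := Real.add_one_le_exp (Real.log 2 * ((n : ℝ) - T))
    linarith
  calc (M.card : ℝ) * (2 : ℝ) ^ T
      ≤ ∑ x ∈ M, (2 : ℝ) ^ T *
          (1 + (((Finset.univ.filter fun l => dec (mem x) l = x l).card : ℝ) - T)
            * Real.log 2) := by
        rw [← Finset.mul_sum, Finset.sum_add_distrib, ← Finset.sum_mul, Finset.sum_sub_distrib,
          mul_comm]
        refine mul_le_mul_of_nonneg_left ?_ (by positivity)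
        simp only [Finset.sum_const, nsmul_eq_mul, mul_one]
        have : 0 ≤ (∑ x ∈ M, ((Finset.univ.filter fun l => dec (mem x) l = x l).card : ℝ)
            - M.card * T) * Real.log 2 :=
          mul_nonneg (by rw [mul_comm] at h; linarith) hlog.le
        linarith
    _ ≤ ∑ x ∈ M, (2 : ℝ) ^ (Finset.univ.filter fun l => dec (mem x) l = x l).card :=
        Finset.sum_le_sum fun x _ => h2 _
    _ ≤ ∑ x : ι → Bool, (2 : ℝ) ^ (Finset.univ.filter fun l => dec (mem x) l = x l).card :=
        Finset.sum_le_sum_of_subset_of_nonneg (Finset.subset_univ _)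
          fun _ _ _ => by positivity
    -- Summing over all memory contents makes the decoded string independent of `x`, at the price of
    -- a factor `2 ^ s`.
    _ ≤ ∑ x : ι → Bool, ∑ m : Fin s → Bool,
          (2 : ℝ) ^ (Finset.univ.filter fun l => dec m l = x l).card :=
        Finset.sum_le_sum fun x _ => Finset.single_le_sum
          (f := fun m => (2 : ℝ) ^ (Finset.univ.filter fun l => dec m l = x l).card)
          (fun _ _ => by positivity) (Finset.mem_univ (mem x))
    _ = 2 ^ s * 3 ^ Fintype.card ι := by
        rw [Finset.sum_comm]
        simp_rw [sum_two_pow_agree]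
        simp

/-- A space lower bound for randomized one-way protocols: if after a message `x ∈ M` of `s` bits
every query `q` is answered with probability `2/3` by a string with few errors, and `M` contains
most bit strings, then `s` is proportional to the length of the strings. -/
lemma le_of_decode {Ω : Type*} [MeasurableSpace Ω] (μ : Measure Ω) [IsProbabilityMeasure μ]
    {Q J : Type*} [Fintype Q] [Fintype J] [DecidableEq Q] [DecidableEq J] {s : ℕ}
    (M : Finset (Q × J → Bool))
    (hM : (2 : ℝ) ^ (0.99 * (Fintype.card (Q × J) : ℝ)) ≤ M.card)
    (mem : Ω → (Q × J → Bool) → (Fin s → Bool))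
    (dec : Ω → Q → (Fin s → Bool) → J → Bool)
    (h : ∀ x ∈ M, ∀ q, ∃ E : Set Ω, MeasurableSet E ∧ 2 / 3 ≤ μ E ∧ ∀ ω ∈ E,
      ((Finset.univ.filter fun j => dec ω q (mem ω x) j ≠ x (q, j)).card : ℝ)
        ≤ Fintype.card J / 40) :
    0.04 * (Fintype.card (Q × J) : ℝ) ≤ s := by
  classical
  have h' : ∀ (x : Q × J → Bool) (q : Q), ∃ E : Set Ω, x ∈ M → (MeasurableSet E ∧ 2 / 3 ≤ μ E ∧
      ∀ ω ∈ E, ((Finset.univ.filter fun j => dec ω q (mem ω x) j ≠ x (q, j)).card : ℝ)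
        ≤ Fintype.card J / 40) := by
    intro x q
    by_cases hx : x ∈ M
    · obtain ⟨E, hE⟩ := h x hx q
      exact ⟨E, fun _ => hE⟩
    · exact ⟨∅, fun hx' => absurd hx' hx⟩
  choose E hE using h'
  have hmeas : ∀ x ∈ M, ∀ q : Q, Measurable ((E x q).indicator (fun _ => (1 : ENNReal))) :=
    fun x hx q => measurable_const.indicator (hE x q hx).1
  -- Averaging fixes one seed for which at least 2/3 of the pairs `(x, q)` succeed.
  obtain ⟨ω, hω⟩ := exists_lintegral_le (μ := μ)
    (f := fun ω => ∑ x ∈ M, ∑ q : Q, (E x q).indicator (fun _ => (1 : ENNReal)) ω) (by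
      rw [lintegral_finsetSum _ fun x hx => Finset.measurable_sum _ fun q _ => hmeas x hx q]
      refine (ENNReal.sum_lt_top.2 fun x hx => ?_).ne
      rw [lintegral_finsetSum _ fun q _ => hmeas x hx q]
      refine ENNReal.sum_lt_top.2 fun q _ => ?_
      rw [lintegral_indicator_const (hE x q hx).1]
      simp [measure_lt_top])
  have hge : (∑ x ∈ M, ∑ q : Q, (2 / 3 : ENNReal))
      ≤ ∑ x ∈ M, ∑ q : Q, (E x q).indicator (fun _ => (1 : ENNReal)) ω := by
    refine le_trans ?_ hω
    rw [lintegral_finsetSum _ fun x hx => Finset.measurable_sum _ fun q _ => hmeas x hx q]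
    refine Finset.sum_le_sum fun x hx => ?_
    rw [lintegral_finsetSum _ fun q _ => hmeas x hx q]
    refine Finset.sum_le_sum fun q _ => ?_
    rw [lintegral_indicator_const (hE x q hx).1, one_mul]
    exact (hE x q hx).2.1
  have hreal : (M.card : ℝ) * (Fintype.card Q * (2 / 3))
      ≤ ∑ x ∈ M, ∑ q : Q, (E x q).indicator (fun _ => (1 : ℝ)) ω := by
    have h3 : ∀ x q, (E x q).indicator (fun _ => (1 : ENNReal)) ω
        = ENNReal.ofReal ((E x q).indicator (fun _ => (1 : ℝ)) ω) := by
      intro x q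
      by_cases hx : ω ∈ E x q <;> simp [hx]
    have h4 : ∀ x q, 0 ≤ (E x q).indicator (fun _ => (1 : ℝ)) ω :=
      fun x q => Set.indicator_nonneg (fun _ _ => zero_le_one) _
    have h5 : (2 / 3 : ENNReal) = ENNReal.ofReal (2 / 3) := by
      rw [ENNReal.ofReal_div_of_pos (by norm_num)]
      norm_num
    simp_rw [h3, h5] at hge
    simp_rw [← ENNReal.ofReal_sum_of_nonneg fun q (_ : q ∈ (Finset.univ : Finset Q)) => h4 _ q] at hge
    rw [← ENNReal.ofReal_sum_of_nonneg fun x _ => Finset.sum_nonneg fun q _ => h4 x q] at hge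
    have h6 : (∑ x ∈ M, ∑ q : Q, ENNReal.ofReal (2 / 3))
        = ENNReal.ofReal ((M.card : ℝ) * (Fintype.card Q * (2 / 3))) := by
      rw [ENNReal.ofReal_mul (by positivity), ENNReal.ofReal_mul (by positivity)]
      simp
    rw [h6] at hge
    exact (ENNReal.ofReal_le_ofReal_iff
      (Finset.sum_nonneg fun x _ => Finset.sum_nonneg fun q _ => h4 x q)).1 hge
  -- A fraction 2/3 of successful pairs, each with 39/40 of the bits correct, gives the agreement
  -- rate 0.65.
  have key := card_mul_le_of_agree M (mem ω) (fun m l => dec ω l.1 m l.2) (by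
    have h7 : ∀ x ∈ M, ∑ q : Q, (E x q).indicator (fun _ => (1 : ℝ)) ω
        * (39 / 40 * Fintype.card J)
        ≤ ((Finset.univ.filter fun l : Q × J => dec ω l.1 (mem ω x) l.2 = x l).card : ℝ) := by
      intro x hx
      rw [Finset.card_filter, Fintype.sum_prod_type]
      push_cast
      refine Finset.sum_le_sum fun q _ => ?_
      have h8 : (∑ j : J, if dec ω q (mem ω x) j = x (q, j) then (1 : ℝ) else 0)
          = ((Finset.univ.filter fun j => dec ω q (mem ω x) j = x (q, j)).card : ℝ) := by
        simp
      rw [h8]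
      by_cases hq : ω ∈ E x q
      · have h9 := (hE x q hx).2.2 ω hq
        have h10 := Finset.card_filter_add_card_filter_not (s := (Finset.univ : Finset J))
          (fun j => dec ω q (mem ω x) j = x (q, j))
        have h11 : ((Finset.univ.filter fun j => dec ω q (mem ω x) j = x (q, j)).card : ℝ)
          + ((Finset.univ.filter fun j => dec ω q (mem ω x) j ≠ x (q, j)).card : ℝ)
            = Fintype.card J := by
          exact_mod_cast h10
        simp only [hq, Set.indicator_of_mem]
        linarith
      · simp [hq]
    refine le_trans ?_ (Finset.sum_le_sum h7)
    simp_rw [← Finset.sum_mul]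
    have := mul_le_mul_of_nonneg_right hreal
      (show (0 : ℝ) ≤ 39 / 40 * Fintype.card J by positivity)
    refine le_trans (le_of_eq ?_) this
    rw [Fintype.card_prod]
    push_cast
    ring)
  set N := Fintype.card (Q × J)
  -- From `3 ^ 5 = 243 ≤ 256 = 2 ^ 8`. The final constant is `0.99 + 0.65 - 1.6 = 0.04`.
  have h3 : (3 : ℝ) ^ N ≤ (2 : ℝ) ^ (1.6 * (N : ℝ)) := by
    rw [Real.rpow_mul (by norm_num), Real.rpow_natCast]
    refine pow_le_pow_left₀ (by norm_num) ?_ _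
    have : ((3 : ℝ) ^ (5 : ℝ)) ^ (1 / 5 : ℝ) ≤ ((2 : ℝ) ^ (8 : ℝ)) ^ (1 / 5 : ℝ) :=
      Real.rpow_le_rpow (by positivity) (by norm_num) (by norm_num)
    rw [← Real.rpow_mul (by norm_num), ← Real.rpow_mul (by norm_num)] at this
    norm_num at this ⊢
    exact this
  have h12 : (2 : ℝ) ^ (0.99 * (N : ℝ) + 0.65 * N) ≤ (2 : ℝ) ^ ((s : ℝ) + 1.6 * N) := by
    rw [Real.rpow_add (by norm_num), Real.rpow_add (by norm_num), Real.rpow_natCast]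
    calc _ ≤ (M.card : ℝ) * (2 : ℝ) ^ (0.65 * (N : ℝ)) := by gcongr
      _ ≤ 2 ^ s * 3 ^ N := key
      _ ≤ _ := by gcongr
  have h13 := (Real.rpow_le_rpow_left_iff (by norm_num)).1 h12
  linarith

end Information

/-! ### Concentration for row sums of sign matrices. -/

section SignMatrices

/-- The sign `±1` encoded by a bit. -/
def sign (b : Bool) : ℝ := if b then 1 else -1

@[simp] lemma sign_sq (b : Bool) : sign b ^ 2 = 1 := by
  cases b <;> norm_num [sign]

lemma sum_exp_sign_sum {r : ℕ} (S : Finset (Fin r)) (v : ℝ) :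
    ∑ x : Fin r → Bool, Real.exp (v * ∑ j ∈ S, sign (x j)) = 2 ^ r * Real.cosh v ^ S.card := by
  have h : ∀ x : Fin r → Bool, Real.exp (v * ∑ j ∈ S, sign (x j))
      = ∏ j, if j ∈ S then Real.exp (v * sign (x j)) else 1 := by
    intro x
    rw [Finset.mul_sum, Real.exp_sum, Finset.prod_ite_mem, Finset.univ_inter]
  simp_rw [h]
  have := Finset.prod_univ_sum (fun _ : Fin r => (Finset.univ : Finset Bool))
    (fun j b => if j ∈ S then Real.exp (v * sign b) else 1)
  rw [Fintype.piFinset_univ] at this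
  rw [← this]
  have h3 : ∀ j, ∑ b : Bool, (if j ∈ S then Real.exp (v * sign b) else 1)
      = 2 * if j ∈ S then Real.cosh v else 1 := by
    intro j
    by_cases hj : j ∈ S
    · simp [hj, sign, Real.cosh_eq]
      ring
    · simp [hj]
  simp_rw [h3]
  rw [Finset.prod_mul_distrib, Finset.prod_ite_mem]
  simp

/-- Completing the square. Read backwards, it writes `exp (u² / 4)` as a Gaussian average of `exp (v
u)`, which factorizes when `u` is a sum of independent signs. -/
lemma integral_exp_neg_sq_add_mul (u : ℝ) :
    ∫ v : ℝ, Real.exp (-1 * v ^ 2 + v * u) = √Real.pi * Real.exp (u ^ 2 / 4) := by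
  have h : ∀ v : ℝ, Real.exp (-1 * v ^ 2 + v * u)
      = Real.exp (-1 * (v - u / 2) ^ 2) * Real.exp (u ^ 2 / 4) := by
    intro v
    rw [← Real.exp_add]
    ring_nf
  simp_rw [h]
  rw [integral_mul_const, integral_sub_right_eq_self (fun v => Real.exp (-1 * v ^ 2)),
    integral_gaussian]
  simp

lemma integrable_exp_neg_sq_add_mul (u : ℝ) :
    Integrable fun v : ℝ => Real.exp (-1 * v ^ 2 + v * u) := by
  have h : ∀ v : ℝ, Real.exp (-1 * v ^ 2 + v * u)
      = Real.exp (-1 * (v - u / 2) ^ 2) * Real.exp (u ^ 2 / 4) := by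
    intro v
    rw [← Real.exp_add]
    ring_nf
  simp_rw [h]
  exact ((integrable_exp_neg_mul_sq one_pos).comp_sub_right (u / 2)).mul_const _

/-- The exponential moment of the square of a normalized Rademacher sum. -/
lemma sum_exp_sq_sign_sum_le {r : ℕ} (S : Finset (Fin r)) (hS : S.Nonempty) :
    ∑ x : Fin r → Bool, Real.exp ((∑ j ∈ S, sign (x j)) ^ 2 / (4 * S.card)) ≤ 2 ^ r * √2 := by
  have ht : (0 : ℝ) < S.card := by exact_mod_cast hS.card_pos
  have hpi : 0 < √Real.pi := Real.sqrt_pos.2 Real.pi_pos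
  set q : ℝ := √(S.card : ℝ) with hq
  have hq0 : 0 < q := Real.sqrt_pos.2 ht
  have hq2 : q ^ 2 = S.card := Real.sq_sqrt ht.le
  refine le_of_mul_le_mul_left ?_ hpi
  calc √Real.pi * ∑ x : Fin r → Bool, Real.exp ((∑ j ∈ S, sign (x j)) ^ 2 / (4 * S.card))
      = ∑ x : Fin r → Bool,
          ∫ v : ℝ, Real.exp (-1 * v ^ 2 + v * ((∑ j ∈ S, sign (x j)) / q)) := by
        rw [Finset.mul_sum]
        refine Finset.sum_congr rfl fun x _ => ?_
        rw [integral_exp_neg_sq_add_mul, div_pow, hq2, div_div, mul_comm (S.card : ℝ) 4]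
    _ = ∫ v : ℝ, ∑ x : Fin r → Bool,
          Real.exp (-1 * v ^ 2 + v * ((∑ j ∈ S, sign (x j)) / q)) :=
        (integral_finsetSum _ fun x _ => integrable_exp_neg_sq_add_mul _).symm
    _ ≤ ∫ v : ℝ, 2 ^ r * Real.exp (-(1 / 2) * v ^ 2) := by
        refine integral_mono (integrable_finsetSum _ fun x _ => integrable_exp_neg_sq_add_mul _)
          ((integrable_exp_neg_mul_sq (by norm_num)).const_mul _) fun v => ?_
        simp only
        have h1 : ∀ x : Fin r → Bool, Real.exp (-1 * v ^ 2 + v * ((∑ j ∈ S, sign (x j)) / q))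
            = Real.exp (-1 * v ^ 2) * Real.exp (v / q * ∑ j ∈ S, sign (x j)) := by
          intro x
          rw [← Real.exp_add]
          congr 2
          ring
        simp_rw [h1]
        rw [← Finset.mul_sum, sum_exp_sign_sum]
        have h2 : Real.cosh (v / q) ^ S.card ≤ Real.exp (v ^ 2 / 2) := by
          calc Real.cosh (v / q) ^ S.card ≤ Real.exp ((v / q) ^ 2 / 2) ^ S.card :=
                pow_le_pow_left₀ (Real.cosh_pos _).le (Real.cosh_le_exp_half_sq _) _
            _ = Real.exp (v ^ 2 / 2) := by
                rw [← Real.exp_nat_mul, div_pow, hq2]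
                congr 1
                field_simp
        calc Real.exp (-1 * v ^ 2) * (2 ^ r * Real.cosh (v / q) ^ S.card)
            ≤ Real.exp (-1 * v ^ 2) * (2 ^ r * Real.exp (v ^ 2 / 2)) := by gcongr
          _ = 2 ^ r * (Real.exp (-1 * v ^ 2) * Real.exp (v ^ 2 / 2)) := by ring
          _ = 2 ^ r * Real.exp (-(1 / 2) * v ^ 2) := by
              rw [← Real.exp_add]
              congr 2
              ring
    _ = √Real.pi * (2 ^ r * √2) := by
        rw [integral_const_mul, integral_gaussian, div_div_eq_mul_div, div_one,
          Real.sqrt_mul Real.pi_pos.le]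
        ring

/-- The sign matrices (given by their columns) all of whose row sums are short: for every set `S`
of rows the sum of these rows has squared norm at most `8 D |S|`. -/
def shortSums (r D : ℕ) : Finset (Fin D → Fin r → Bool) :=
  Finset.univ.filter fun x => ∀ S : Finset (Fin r),
    ∑ l, (∑ j ∈ S, sign (x l j)) ^ 2 ≤ 8 * D * S.card

/-- Chernoff's method: the columns are independent and each contributes an exponential moment at
most `√2`. The threshold `8 D |S|` gives the exponent `2 D`, and `√2 / e² ≤ (3/2) / 7`. The base
`3/14` lies below `1/2`, so the estimate survives a union bound over `2 ^ r ≤ 2 ^ D` sets. -/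
lemma card_long_sums_le {r D : ℕ} (S : Finset (Fin r)) (hS : S.Nonempty) :
    ((Finset.univ.filter fun x : Fin D → Fin r → Bool =>
      8 * D * S.card < ∑ l, (∑ j ∈ S, sign (x l j)) ^ 2).card : ℝ)
      ≤ 2 ^ (r * D) * (3 / 14) ^ D := by
  have ht : (0 : ℝ) < S.card := by exact_mod_cast hS.card_pos
  have hsum : ∑ x : Fin D → Fin r → Bool,
      Real.exp ((∑ l, (∑ j ∈ S, sign (x l j)) ^ 2) / (4 * S.card)) ≤ (2 ^ r * √2) ^ D := by
    have h : ∀ x : Fin D → Fin r → Bool,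
        Real.exp ((∑ l, (∑ j ∈ S, sign (x l j)) ^ 2) / (4 * S.card))
        = ∏ l, Real.exp ((∑ j ∈ S, sign (x l j)) ^ 2 / (4 * S.card)) := by
      intro x
      rw [Finset.sum_div, Real.exp_sum]
    simp_rw [h]
    have := Finset.prod_univ_sum (fun _ : Fin D => (Finset.univ : Finset (Fin r → Bool)))
      (fun _ y => Real.exp ((∑ j ∈ S, sign (y j)) ^ 2 / (4 * S.card)))
    rw [Fintype.piFinset_univ] at this
    rw [← this, Finset.prod_const, Finset.card_univ, Fintype.card_fin]
    exact pow_le_pow_left₀ (Finset.sum_nonneg fun _ _ => (Real.exp_pos _).le)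
      (sum_exp_sq_sign_sum_le S hS) _
  set B := Finset.univ.filter fun x : Fin D → Fin r → Bool =>
      (8 * D * S.card : ℝ) < ∑ l, (∑ j ∈ S, sign (x l j)) ^ 2
  have hB : (B.card : ℝ) * Real.exp (2 * D) ≤ (2 ^ r * √2) ^ D := by
    refine le_trans ?_ (le_trans (Finset.sum_le_sum_of_subset_of_nonneg (Finset.subset_univ B)
      fun _ _ _ => (Real.exp_pos _).le) hsum)
    rw [← nsmul_eq_mul]
    refine Finset.card_nsmul_le_sum _ _ _ fun x hx => Real.exp_le_exp.2 ?_
    rw [le_div_iff₀ (by positivity)]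
    have := (Finset.mem_filter.1 hx).2
    linarith
  have he : (7 : ℝ) ≤ Real.exp 2 := by
    have h1 := Real.exp_one_gt_d9
    have h2 : Real.exp 2 = Real.exp 1 * Real.exp 1 := by
      rw [← Real.exp_add]
      norm_num
    nlinarith
  have hs : √2 ≤ 3 / 2 := by
    rw [Real.sqrt_le_left (by norm_num)]
    norm_num
  have heD : Real.exp (2 * D) = Real.exp 2 ^ D := by
    rw [← Real.exp_nat_mul, mul_comm]
  have h7 : (B.card : ℝ) * 7 ^ D ≤ (2 ^ r * (3 / 2)) ^ D := by
    calc (B.card : ℝ) * 7 ^ D ≤ B.card * Real.exp (2 * D) := by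
          rw [heD]
          gcongr
      _ ≤ _ := hB
      _ ≤ _ := by gcongr
  have e : (2 : ℝ) ^ (r * D) * (3 / 14) ^ D = (2 ^ r * (3 / 2)) ^ D / 7 ^ D := by
    rw [← div_pow, pow_mul, ← mul_pow]
    congr 1
    ring
  rw [e, le_div_iff₀ (by positivity)]
  exact h7

/-- At least half of the sign matrices with no more rows than columns have short row sums. -/
lemma half_le_card_shortSums {r D : ℕ} (hD : 1 ≤ D) (hr : r ≤ D) :
    (2 : ℝ) ^ (r * D) / 2 ≤ (shortSums r D).card := by
  classical
  have hc : (shortSums r D)ᶜ ⊆ (Finset.univ.filter fun S : Finset (Fin r) => S.Nonempty).biUnion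
      fun S => Finset.univ.filter fun x : Fin D → Fin r → Bool =>
        (8 * D * S.card : ℝ) < ∑ l, (∑ j ∈ S, sign (x l j)) ^ 2 := by
    intro x hx
    simp only [shortSums, Finset.mem_compl, Finset.mem_filter, Finset.mem_univ, true_and,
      not_forall, not_le] at hx
    obtain ⟨S, hS⟩ := hx
    simp only [Finset.mem_biUnion, Finset.mem_filter, Finset.mem_univ, true_and]
    refine ⟨S, ?_, hS⟩
    rw [Finset.nonempty_iff_ne_empty]
    rintro rfl
    simp at hS
  have h1 : (((shortSums r D)ᶜ).card : ℝ) ≤ 2 ^ (r * D) / 2 := by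
    calc (((shortSums r D)ᶜ).card : ℝ)
        ≤ ∑ S ∈ Finset.univ.filter fun S : Finset (Fin r) => S.Nonempty,
          ((Finset.univ.filter fun x : Fin D → Fin r → Bool =>
            (8 * D * S.card : ℝ) < ∑ l, (∑ j ∈ S, sign (x l j)) ^ 2).card : ℝ) := by
          exact_mod_cast (Finset.card_le_card hc).trans Finset.card_biUnion_le
      _ ≤ ∑ S ∈ Finset.univ.filter fun S : Finset (Fin r) => S.Nonempty,
          (2 : ℝ) ^ (r * D) * (3 / 14) ^ D :=
          Finset.sum_le_sum fun S hS => card_long_sums_le S (Finset.mem_filter.1 hS).2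
      _ ≤ ∑ S : Finset (Fin r), (2 : ℝ) ^ (r * D) * (3 / 14) ^ D :=
          Finset.sum_le_sum_of_subset_of_nonneg (Finset.subset_univ _)
            fun _ _ _ => by positivity
      _ = 2 ^ r * ((2 : ℝ) ^ (r * D) * (3 / 14) ^ D) := by simp
      _ ≤ 2 ^ D * ((2 : ℝ) ^ (r * D) * (3 / 14) ^ D) := by
          gcongr
          norm_num
      _ = 2 ^ (r * D) * (3 / 7) ^ D := by
          rw [mul_left_comm, ← mul_pow]
          norm_num
      _ ≤ 2 ^ (r * D) * (1 / 2) := by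
          gcongr
          calc (3 / 7 : ℝ) ^ D ≤ (3 / 7) ^ 1 :=
                pow_le_pow_of_le_one (by norm_num) (by norm_num) hD
            _ ≤ 1 / 2 := by norm_num
      _ = _ := by ring
  have h2 := Finset.card_add_card_compl (shortSums r D)
  have h3 : ((shortSums r D).card : ℝ) + ((shortSums r D)ᶜ).card = 2 ^ (r * D) := by
    have h4 : Fintype.card (Fin D → Fin r → Bool) = 2 ^ (r * D) := by
      simp [pow_mul]
    rw [h4] at h2
    exact_mod_cast h2
  linarith

end SignMatrices

/-! ### Stability of the planted clustering in one group. -/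

section Group

variable {V : Type*} [NormedAddCommGroup V] [InnerProductSpace ℝ V]

/-- The left side is the saving when `t` points with sum `x` are served by `c` instead of the
origin; completing the square shows that their mean is the best choice. -/
lemma two_inner_sub_eq (x c : V) {t : ℝ} (ht : 0 < t) :
    2 * inner ℝ x c - t * ‖c‖ ^ 2 = ‖x‖ ^ 2 / t - t * ‖c - t⁻¹ • x‖ ^ 2 := by
  rw [norm_sub_sq_real, norm_smul, inner_smul_right, real_inner_comm, mul_pow, Real.norm_eq_abs,
    sq_abs]
  field_simp
  ring

lemma two_inner_sub_le (x c : V) {t : ℝ} (ht : 0 < t) :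
    2 * inner ℝ x c - t * ‖c‖ ^ 2 ≤ ‖x‖ ^ 2 / t := by
  rw [two_inner_sub_eq x c ht]
  have : 0 ≤ t * ‖c - t⁻¹ • x‖ ^ 2 := by positivity
  linarith

set_option maxHeartbeats 1000000 in
/-- The stability of the planted clustering of a group. The group consists of the points `a j`, of
two copies of `p` and of `Z` copies of the origin; the points are assigned to the centers `c` by
`f`, `P` and `A`. Every center used costs an additional `lam`. Then the cost exceeds that of the
clustering `{a i, p, p}` versus rest by a constant multiple of `D`, or the center of `p` is close to
the mean of `a i, p, p`. -/
lemma group_stability {κ : Type*} [DecidableEq κ] {r : ℕ} (a : Fin r → V) (p : V) (i : Fin r)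
    {R2 D Z lam : ℝ} (hD : 0 ≤ D) (hR : 32 * D ≤ R2) (hlam : lam = R2 + 8 * D) (hZ : 0 < Z)
    (hsum : ∀ S : Finset (Fin r), ‖∑ j ∈ S, a j‖ ^ 2 ≤ lam * S.card)
    (hp : ‖p‖ ^ 2 = R2) (hai : inner ℝ (a i) p = R2) (haj : ∀ j ≠ i, inner ℝ (a j) p = 0)
    (ha : ∀ j, ‖a j‖ ^ 2 = R2 + D)
    (c : κ → V) (f : Fin r → κ) (P A : κ) (defect : ℝ)
    (hdef : defect = ∑ j, ‖a j - c (f j)‖ ^ 2 + 2 * ‖p - c P‖ ^ 2 + Z * ‖c A‖ ^ 2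
      + lam * ((insert P (insert A (Finset.univ.image f))).card : ℝ)
      - ((r - 1) * (R2 + D) + 2 / 3 * D) - 2 * lam + 10 * lam * r / Z) :
    D ≤ defect ∨ 3 * ‖c P - (3 : ℝ)⁻¹ • (a i + (2 : ℝ) • p)‖ ^ 2 ≤ defect := by
  set Im := insert P (insert A (Finset.univ.image f)) with hIm
  have hR2 : 0 ≤ R2 := by linarith
  have hlam0 : 0 ≤ lam := by linarith
  have hr : (1 : ℝ) ≤ r := by exact_mod_cast Fin.pos i
  set τ := 10 * lam * r / Z with hτ
  have hτ0 : 0 ≤ τ := by positivity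
  let S : κ → Finset (Fin r) := fun x => Finset.univ.filter fun j => f j = x
  have hSr : ∀ x, ((S x).card : ℝ) ≤ r := by
    intro x
    have := Finset.card_le_univ (S x)
    rw [Fintype.card_fin] at this
    exact_mod_cast this
  -- The saving of center `x` on its code points, compared with serving them from the origin.
  let w : κ → ℝ := fun x => 2 * inner ℝ (∑ j ∈ S x, a j) (c x) - (S x).card * ‖c x‖ ^ 2
  have hcost : ∑ j, ‖a j - c (f j)‖ ^ 2 = r * (R2 + D) - ∑ x ∈ Im, w x := by
    have hmaps : ∀ j ∈ (Finset.univ : Finset (Fin r)), f j ∈ Im := fun j hj =>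
      Finset.mem_insert_of_mem (Finset.mem_insert_of_mem (Finset.mem_image_of_mem f hj))
    have h1 : ∀ j, ‖a j - c (f j)‖ ^ 2
        = (R2 + D) - (2 * inner ℝ (a j) (c (f j)) - ‖c (f j)‖ ^ 2) := by
      intro j
      rw [norm_sub_sq_real, ha j]
      ring
    simp_rw [h1]
    rw [Finset.sum_sub_distrib, ← Finset.sum_fiberwise_of_maps_to hmaps
      fun j => 2 * inner ℝ (a j) (c (f j)) - ‖c (f j)‖ ^ 2]
    congr 1
    · rw [Finset.sum_const, Finset.card_univ, Fintype.card_fin, nsmul_eq_mul]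
    · refine Finset.sum_congr rfl fun x _ => ?_
      simp only [w]
      rw [sum_inner, Finset.mul_sum, ← nsmul_eq_mul, ← Finset.sum_const, ← Finset.sum_sub_distrib]
      refine Finset.sum_congr rfl fun j hj => ?_
      rw [(Finset.mem_filter.1 hj).2]
  have hpP : 2 * ‖p - c P‖ ^ 2 = 2 * R2 - 2 * (2 * inner ℝ p (c P) - ‖c P‖ ^ 2) := by
    rw [norm_sub_sq_real, hp]
    ring
  have hw : ∀ x, w x ≤ lam := by
    intro x
    rcases (S x).eq_empty_or_nonempty with h0 | h0
    · simp only [w, h0]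
      simpa using hlam0
    · have ht : (0 : ℝ) < (S x).card := by exact_mod_cast h0.card_pos
      refine (two_inner_sub_le _ _ ht).trans ?_
      rw [div_le_iff₀ ht]
      exact hsum _
  have hPm : P ∈ Im := Finset.mem_insert_self _ _
  have hAm : A ∈ Im := Finset.mem_insert_of_mem (Finset.mem_insert_self _ _)
  have hinner : ∀ T : Finset (Fin r), inner ℝ (∑ j ∈ T, a j) p = if i ∈ T then R2 else 0 := by
    intro T
    rw [sum_inner]
    have : ∀ j, inner ℝ (a j) p = if j = i then R2 else 0 := by
      intro j
      split_ifs with h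
      · rw [h, hai]
      · exact haj j h
    simp_rw [this]
    simp
  have hnorm : ∀ T : Finset (Fin r), ‖∑ j ∈ T, a j + (2 : ℝ) • p‖ ^ 2
      = ‖∑ j ∈ T, a j‖ ^ 2 + 4 * (if i ∈ T then R2 else 0) + 4 * R2 := by
    intro T
    rw [norm_add_sq_real, inner_smul_right, hinner, norm_smul, mul_pow, hp]
    have h4 : ‖(2 : ℝ)‖ ^ 2 = 4 := by norm_num
    rw [h4]
    ring
  -- If `p` and the origin share a center, the `Z` anchors hold it near the origin. It saves at most
  -- `τ` in all, and the unserved copies of `p` cost about `2 R2`.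
  by_cases hPA : A = P
  · left
    have hsplit : ∑ x ∈ Im, w x ≤ w P + ((Im.card : ℝ) - 1) * lam := by
      rw [← Finset.add_sum_erase _ _ hPm]
      have h1 : ∑ x ∈ Im.erase P, w x ≤ (Im.erase P).card • lam :=
        Finset.sum_le_card_nsmul _ _ _ fun x _ => hw x
      rw [nsmul_eq_mul, Finset.card_erase_of_mem hPm,
        Nat.cast_sub (Finset.card_pos.2 ⟨P, hPm⟩)] at h1
      push_cast at h1
      linarith
    have hPs : w P + 2 * (2 * inner ℝ p (c P) - ‖c P‖ ^ 2) - Z * ‖c P‖ ^ 2 ≤ τ := by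
      have h1 := two_inner_sub_le (∑ j ∈ S P, a j + (2 : ℝ) • p) (c P)
        (t := (S P).card + 2 + Z) (by positivity)
      rw [inner_add_left, inner_smul_left] at h1
      have h2 : ‖∑ j ∈ S P, a j + (2 : ℝ) • p‖ ^ 2 / ((S P).card + 2 + Z) ≤ τ := by
        rw [hτ]
        have h3 : ‖∑ j ∈ S P, a j + (2 : ℝ) • p‖ ^ 2 ≤ 10 * lam * r := by
          rw [hnorm]
          have h4 := hsum (S P)
          have h5 : lam * (S P).card ≤ lam * r := mul_le_mul_of_nonneg_left (hSr P) hlam0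
          have h6 : lam * 1 ≤ lam * r := mul_le_mul_of_nonneg_left hr hlam0
          split_ifs <;> linarith
        refine div_le_div₀ (by positivity) h3 hZ ?_
        have : (0 : ℝ) ≤ (S P).card := by positivity
        linarith
      simp only [w, conj_trivial] at h1 ⊢
      linarith
    rw [hPA] at hdef
    linarith
  · have hAm' : A ∈ Im.erase P := Finset.mem_erase.2 ⟨hPA, hAm⟩
    have hsplit : ∑ x ∈ Im, w x ≤ w P + w A + ((Im.card : ℝ) - 2) * lam := by
      rw [← Finset.add_sum_erase _ _ hPm, ← Finset.add_sum_erase _ _ hAm']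
      have h1 : ∑ x ∈ (Im.erase P).erase A, w x ≤ ((Im.erase P).erase A).card • lam :=
        Finset.sum_le_card_nsmul _ _ _ fun x _ => hw x
      have h2 : ((Im.erase P).erase A).card + 2 = Im.card := by
        rw [Finset.card_erase_of_mem hAm', Finset.card_erase_of_mem hPm]
        have h3 : 0 < (Im.erase P).card := Finset.card_pos.2 ⟨A, hAm'⟩
        rw [Finset.card_erase_of_mem hPm] at h3
        omega
      have h4 : (((Im.erase P).erase A).card : ℝ) + 2 = Im.card := by exact_mod_cast h2
      rw [nsmul_eq_mul] at h1
      rw [← h4]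
      linarith
    have hAs : w A - Z * ‖c A‖ ^ 2 ≤ τ := by
      have h1 := two_inner_sub_le (∑ j ∈ S A, a j) (c A) (t := (S A).card + Z) (by positivity)
      have h2 : ‖∑ j ∈ S A, a j‖ ^ 2 / ((S A).card + Z) ≤ τ := by
        refine div_le_div₀ (by positivity) ((hsum _).trans ?_) hZ (by simp)
        have h5 : lam * (S A).card ≤ lam * r := mul_le_mul_of_nonneg_left (hSr A) hlam0
        have h6 : 0 ≤ lam * r := by positivity
        linarith
      simp only [w]
      linarith
    have hP0 : w P + 2 * (2 * inner ℝ p (c P) - ‖c P‖ ^ 2)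
        = 2 * inner ℝ (∑ j ∈ S P, a j + (2 : ℝ) • p) (c P)
          - ((S P).card + 2) * ‖c P‖ ^ 2 := by
      simp only [w]
      rw [inner_add_left, inner_smul_left]
      simp only [conj_trivial]
      ring
    have hPle := two_inner_sub_le (∑ j ∈ S P, a j + (2 : ℝ) • p) (c P)
      (t := (S P).card + 2) (by positivity)
    have hcard0 : (0 : ℝ) ≤ (S P).card := by positivity
    have hred : defect = r * (R2 + D) - ∑ x ∈ Im, w x
        + (2 * R2 - 2 * (2 * inner ℝ p (c P) - ‖c P‖ ^ 2)) + Z * ‖c A‖ ^ 2 + lam * Im.card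
        - ((r - 1) * (R2 + D) + 2 / 3 * D) - 2 * lam + τ := by
      rw [hdef, hcost, hpP]
    -- With separate centers the defect is at least `3 R2 + D / 3` minus the joint saving of center
    -- `P` on its code points and both copies of `p`. The planted choice `S P = {i}` can save `3 R2
    -- + D / 3`, leaving exactly the squared distance term. Every other choice saves at least `D`
    -- less.
    by_cases hiP : i ∈ S P
    · by_cases hS1 : S P = {i}
      · right
        have h1 : 2 * inner ℝ (a i + (2 : ℝ) • p) (c P) - 3 * ‖c P‖ ^ 2
            = ‖a i + (2 : ℝ) • p‖ ^ 2 / 3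
              - 3 * ‖c P - (3 : ℝ)⁻¹ • (a i + (2 : ℝ) • p)‖ ^ 2 :=
          two_inner_sub_eq _ _ (by norm_num)
        have h2 := hnorm {i}
        simp only [Finset.sum_singleton, Finset.mem_singleton, if_true, ha] at h2
        rw [h2] at h1
        rw [hS1] at hP0
        simp only [Finset.sum_singleton, Finset.card_singleton, Nat.cast_one] at hP0
        norm_num at hP0
        linarith
      · left
        have hc2 : 2 ≤ (S P).card := by
          by_contra hlt
          have h1 : (S P).card = 1 := by
            have := Finset.card_pos.2 ⟨i, hiP⟩
            omega
          obtain ⟨j, hj⟩ := Finset.card_eq_one.1 h1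
          rw [hj, Finset.mem_singleton] at hiP
          exact hS1 (by rw [hj, hiP])
        have hc2' : (2 : ℝ) ≤ (S P).card := by exact_mod_cast hc2
        have h1 : ‖∑ j ∈ S P, a j + (2 : ℝ) • p‖ ^ 2 / ((S P).card + 2)
            ≤ 3 * R2 - 2 / 3 * D := by
          rw [div_le_iff₀ (by positivity), hnorm, if_pos hiP]
          have := hsum (S P)
          subst hlam
          nlinarith [mul_nonneg (sub_nonneg.2 hc2') (sub_nonneg.2 hR),
            mul_nonneg (sub_nonneg.2 hc2') hD]
        linarith
    · left
      have h1 : ‖∑ j ∈ S P, a j + (2 : ℝ) • p‖ ^ 2 / ((S P).card + 2) ≤ 2 * R2 := by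
        rw [div_le_iff₀ (by positivity), hnorm, if_neg hiP]
        have := hsum (S P)
        subst hlam
        nlinarith [mul_nonneg hcard0 (sub_nonneg.2 hR), mul_nonneg hcard0 hD]
      linarith

end Group

/-! ### From streaming algorithms to one-way protocols. -/

section Reduction

lemma RowArrivalAlgorithm.runFrom_append {Ω : Type*} {d k s : ℕ}
    (A : RowArrivalAlgorithm Ω d k s) (ω : Ω) (l₁ l₂ : List (EuclideanSpace ℝ (Fin d)))
    (t : ℕ) (σ : Fin s → Bool) :
    A.runFrom ω t σ (l₁ ++ l₂) = A.runFrom ω (t + l₁.length) (A.runFrom ω t σ l₁) l₂ := by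
  induction l₁ generalizing t σ with
  | nil => rfl
  | cons a l ih =>
    simp only [List.cons_append, RowArrivalAlgorithm.runFrom, List.length_cons, ih]
    congr 1
    omega

/-- The memory needed by an algorithm that solves instances into which one-way protocols can be
translated: the bits `x` determine the beginning of the stream, the query `q` the rest. -/
lemma RowArrivalAlgorithm.le_of_reduction {Ω : Type*} [MeasurableSpace Ω] (μ : Measure Ω)
    [IsProbabilityMeasure μ] {d k s : ℕ} (A : RowArrivalAlgorithm Ω d k s) {ε : ℝ}
    {Q J : Type*} [Fintype Q] [Fintype J] [DecidableEq Q] [DecidableEq J]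
    (M : Finset (Q × J → Bool))
    (hM : (2 : ℝ) ^ (0.99 * (Fintype.card (Q × J) : ℝ)) ≤ M.card)
    (first : (Q × J → Bool) → List (EuclideanSpace ℝ (Fin d)))
    (second : Q → List (EuclideanSpace ℝ (Fin d))) (t : ℕ) (ht : ∀ x, (first x).length = t)
    (decode : Q → (Fin k → EuclideanSpace ℝ (Fin d)) → J → Bool)
    (hA : ∀ x ∈ M, ∀ q, A.SucceedsOn μ ε (first x ++ second q))
    (hdec : ∀ x ∈ M, ∀ q, ∀ c, IsApproxOptimal ε (first x ++ second q) c →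
      ((Finset.univ.filter fun j => decode q c j ≠ x (q, j)).card : ℝ) ≤ Fintype.card J / 40) :
    0.04 * (Fintype.card (Q × J) : ℝ) ≤ s := by
  refine le_of_decode μ M hM (fun ω x => A.runFrom ω 0 (A.init ω) (first x))
    (fun ω q σ => decode q (A.output ω (t + (second q).length) (A.runFrom ω t σ (second q))))
    fun x hx q => ?_
  obtain ⟨E, hE, hEc, hμ⟩ := hA x hx q
  refine ⟨E, hE, hμ, fun ω hω => ?_⟩
  have h := hdec x hx q _ (hEc ω hω)
  unfold RowArrivalAlgorithm.centers at h
  rw [A.runFrom_append, List.length_append, ht x, Nat.zero_add] at h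
  exact h

end Reduction

/-! ### The cost as a sum over nearest centers. -/

section Cost

variable {d k : ℕ}

/-- The list of the points of a finite family, in some order. -/
def pointList {ι : Type*} [Fintype ι] (f : ι → EuclideanSpace ℝ (Fin d)) :
    List (EuclideanSpace ℝ (Fin d)) :=
  (Finset.univ : Finset ι).toList.map f

@[simp] lemma length_pointList {ι : Type*} [Fintype ι] (f : ι → EuclideanSpace ℝ (Fin d)) :
    (pointList f).length = Fintype.card ι := by
  simp [pointList]

lemma mem_pointList {ι : Type*} [Fintype ι] {f : ι → EuclideanSpace ℝ (Fin d)}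
    {a : EuclideanSpace ℝ (Fin d)} : a ∈ pointList f ↔ ∃ i, f i = a := by
  simp [pointList]

lemma cost_append (l₁ l₂ : List (EuclideanSpace ℝ (Fin d)))
    (c : Fin k → EuclideanSpace ℝ (Fin d)) : cost (l₁ ++ l₂) c = cost l₁ c + cost l₂ c := by
  simp [cost]

lemma cost_pointList {ι : Type*} [Fintype ι] (f : ι → EuclideanSpace ℝ (Fin d))
    (c : Fin k → EuclideanSpace ℝ (Fin d)) :
    cost (pointList f) c = ∑ i, ⨅ j, ‖f i - c j‖ ^ 2 := by
  rw [cost, pointList, List.map_map, ← Finset.sum_map_toList]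
  rfl

lemma cost_nonneg (l : List (EuclideanSpace ℝ (Fin d)))
    (c : Fin k → EuclideanSpace ℝ (Fin d)) : 0 ≤ cost l c := by
  refine List.sum_nonneg fun x hx => ?_
  obtain ⟨a, -, rfl⟩ := List.mem_map.1 hx
  exact Real.iInf_nonneg fun j => by positivity

lemma opt_le_cost (l : List (EuclideanSpace ℝ (Fin d)))
    (c : Fin k → EuclideanSpace ℝ (Fin d)) : opt k l ≤ cost l c :=
  ciInf_le ⟨0, by rintro _ ⟨c', rfl⟩; exact cost_nonneg l c'⟩ c

lemma iInf_le_dist (a : EuclideanSpace ℝ (Fin d)) (c : Fin k → EuclideanSpace ℝ (Fin d))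
    (j : Fin k) : ⨅ j, ‖a - c j‖ ^ 2 ≤ ‖a - c j‖ ^ 2 :=
  ciInf_le ⟨0, by rintro _ ⟨j', rfl⟩; positivity⟩ j

/-- The index of a center nearest to `a`. -/
def nearest [NeZero k] (c : Fin k → EuclideanSpace ℝ (Fin d)) (a : EuclideanSpace ℝ (Fin d)) :
    Fin k :=
  (Finite.exists_min fun j => ‖a - c j‖ ^ 2).choose

lemma iInf_eq_nearest [NeZero k] (c : Fin k → EuclideanSpace ℝ (Fin d))
    (a : EuclideanSpace ℝ (Fin d)) : ⨅ j, ‖a - c j‖ ^ 2 = ‖a - c (nearest c a)‖ ^ 2 :=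
  le_antisymm (iInf_le_dist a c _)
    (le_ciInf (Finite.exists_min fun j => ‖a - c j‖ ^ 2).choose_spec)

end Cost

/-! ### Splitting off an offset coordinate; integrality; reading bits. -/

section Coordinates

variable {d : ℕ} {ι : Type*}

/-- The point with one coordinate `t` and the others given by `v`. -/
def lift (e : Fin d ≃ Option ι) (t : ℝ) (v : EuclideanSpace ℝ ι) : EuclideanSpace ℝ (Fin d) :=
  WithLp.toLp 2 fun l => (e l).elim t v

/-- The first coordinate with respect to a splitting of the coordinates. -/
def offset (e : Fin d ≃ Option ι) (x : EuclideanSpace ℝ (Fin d)) : ℝ := x (e.symm none)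

/-- The remaining coordinates with respect to a splitting of the coordinates. -/
def rest (e : Fin d ≃ Option ι) (x : EuclideanSpace ℝ (Fin d)) : EuclideanSpace ℝ ι :=
  WithLp.toLp 2 fun l => x (e.symm (some l))

lemma norm_lift_sub_sq [Fintype ι] (e : Fin d ≃ Option ι) (t : ℝ) (v : EuclideanSpace ℝ ι)
    (x : EuclideanSpace ℝ (Fin d)) :
    ‖lift e t v - x‖ ^ 2 = (t - offset e x) ^ 2 + ‖v - rest e x‖ ^ 2 := by
  rw [EuclideanSpace.real_norm_sq_eq, EuclideanSpace.real_norm_sq_eq, ← e.symm.sum_comp,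
    Fintype.sum_option]
  simp [lift, offset, rest]

@[simp] lemma offset_lift (e : Fin d ≃ Option ι) (t : ℝ) (v : EuclideanSpace ℝ ι) :
    offset e (lift e t v) = t := by
  simp [lift, offset]

@[simp] lemma rest_lift (e : Fin d ≃ Option ι) (t : ℝ) (v : EuclideanSpace ℝ ι) :
    rest e (lift e t v) = v := by
  ext l
  simp [lift, rest]

lemma exists_int_lift {Δ : ℕ} (e : Fin d ≃ Option ι) {t : ℝ} {v : EuclideanSpace ℝ ι}
    (ht : ∃ z : ℤ, |z| ≤ (Δ : ℤ) ∧ t = z) (hv : ∀ l, ∃ z : ℤ, |z| ≤ (Δ : ℤ) ∧ v l = z)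
    (l : Fin d) : ∃ z : ℤ, |z| ≤ (Δ : ℤ) ∧ lift e t v l = (z : ℝ) := by
  simp only [lift]
  rcases e l with _ | l'
  · exact ht
  · exact hv l'

lemma exists_int_sign {Δ : ℕ} (hΔ : 1 ≤ Δ) (b : Bool) :
    ∃ z : ℤ, |z| ≤ (Δ : ℤ) ∧ sign b = z := by
  cases b
  · exact ⟨-1, by simpa using hΔ, by simp [sign]⟩
  · exact ⟨1, by simpa using hΔ, by simp [sign]⟩

lemma exists_int_natCast {Δ n : ℕ} (hn : n ≤ Δ) : ∃ z : ℤ, |z| ≤ (Δ : ℤ) ∧ (n : ℝ) = z :=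
  ⟨n, by simpa using hn, by simp⟩

/-- The bit read off a real number that approximates a multiple of a sign. -/
def bit (y : ℝ) : Bool := decide (0 < y)

@[simp] lemma bit_sign (b : Bool) : bit (sign b) = b := by
  cases b <;> norm_num [bit, sign]

/-- The target is `±1/3`, so a wrongly read sign means an error of at least `1/3`. -/
lemma le_sq_of_bit_ne {y : ℝ} {b : Bool} (h : bit y ≠ b) :
    1 / 9 ≤ (y - 3⁻¹ * sign b) ^ 2 := by
  cases b
  · have hy : 0 < y := by simpa [bit] using h
    simp only [sign]
    norm_num
    nlinarith
  · have hy : y ≤ 0 := by simpa [bit] using h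
    simp only [sign]
    norm_num
    nlinarith

end Coordinates

/-! ### Large `ε`: instances of optimal cost zero. -/

section LargeAccuracy

variable {d k D : ℕ}

/-- `k` points, the `g`-th of which has offset `g` and carries `D` bits. -/
def bitPoints (e : Fin d ≃ Option (Fin D)) (x : Unit × (Fin k × Fin D) → Bool) :
    List (EuclideanSpace ℝ (Fin d)) :=
  pointList fun g : Fin k => lift e ((g : ℕ) : ℝ) (WithLp.toLp 2 fun l => sign (x ((), (g, l))))

/-- The index of a center whose offset is nearest to `t`. -/
def nearestOffset [NeZero k] (e : Fin d ≃ Option (Fin D))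
    (c : Fin k → EuclideanSpace ℝ (Fin d)) (t : ℝ) : Fin k :=
  (Finite.exists_min fun j => (t - offset e (c j)) ^ 2).choose

lemma opt_bitPoints_nonpos [NeZero k] (e : Fin d ≃ Option (Fin D))
    (x : Unit × (Fin k × Fin D) → Bool) : opt k (bitPoints e x) ≤ 0 := by
  refine (opt_le_cost _ fun g : Fin k =>
    lift e ((g : ℕ) : ℝ) (WithLp.toLp 2 fun l => sign (x ((), (g, l))))).trans ?_
  rw [bitPoints, cost_pointList]
  refine Finset.sum_nonpos fun g _ => (iInf_le_dist _ _ g).trans ?_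
  simp

/-- Zero cost puts a center at each of the `k` distinct points. There are only `k` centers, so none
is left over to mislead the choice by nearest offset. -/
lemma rest_eq_of_cost_nonpos [NeZero k] (e : Fin d ≃ Option (Fin D))
    (x : Unit × (Fin k × Fin D) → Bool) (c : Fin k → EuclideanSpace ℝ (Fin d))
    (hc : cost (bitPoints e x) c ≤ 0) (g : Fin k) (l : Fin D) :
    rest e (c (nearestOffset e c ((g : ℕ) : ℝ))) l = sign (x ((), (g, l))) := by
  rw [bitPoints, cost_pointList] at hc
  set a : Fin k → EuclideanSpace ℝ (Fin d) := fun g =>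
    lift e ((g : ℕ) : ℝ) (WithLp.toLp 2 fun l => sign (x ((), (g, l)))) with ha
  have hnn : ∀ g ∈ (Finset.univ : Finset (Fin k)), 0 ≤ ⨅ j, ‖a g - c j‖ ^ 2 :=
    fun g _ => Real.iInf_nonneg fun j => by positivity
  have h0 := (Finset.sum_eq_zero_iff_of_nonneg hnn).1 (le_antisymm hc (Finset.sum_nonneg hnn))
  have hφ : ∀ g, c (nearest c (a g)) = a g := by
    intro g
    have := h0 g (Finset.mem_univ g)
    rw [iInf_eq_nearest, sq_eq_zero_iff, norm_eq_zero, sub_eq_zero] at this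
    exact this.symm
  have hoff : ∀ g, offset e (a g) = ((g : ℕ) : ℝ) := fun g => by simp [ha]
  have hinj : Function.Injective fun g => nearest c (a g) := by
    intro g g' h
    have h1 : a g = a g' := by
      rw [← hφ g, ← hφ g']
      exact congrArg c h
    have h2 := congrArg (offset e) h1
    rw [hoff, hoff] at h2
    exact Fin.ext (by exact_mod_cast h2)
  obtain ⟨g', hg'⟩ := (Finite.injective_iff_surjective.1 hinj)
    (nearestOffset e c ((g : ℕ) : ℝ))
  have hmin := (Finite.exists_min
    fun j => (((g : ℕ) : ℝ) - offset e (c j)) ^ 2).choose_spec (nearest c (a g))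
  change (((g : ℕ) : ℝ) - offset e (c (nearestOffset e c ((g : ℕ) : ℝ)))) ^ 2 ≤ _ at hmin
  simp only at hg'
  rw [hφ, hoff, ← hg', hφ, hoff, sub_self] at hmin
  have h3 : ((g : ℕ) : ℝ) - ((g' : ℕ) : ℝ) = 0 := by
    have : (((g : ℕ) : ℝ) - ((g' : ℕ) : ℝ)) ^ 2 = 0 := by
      refine le_antisymm (by simpa using hmin) (by positivity)
    exact pow_eq_zero_iff (by norm_num) |>.1 this
  have h4 : g = g' := Fin.ext (by exact_mod_cast sub_eq_zero.1 h3)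
  rw [← hg', hφ, ← h4]
  simp [ha]

/-- An algorithm that clusters `k` points exactly remembers all of their coordinates. -/
lemma le_of_succeedsOn_bitPoints {Ω : Type*} [MeasurableSpace Ω] (μ : Measure Ω)
    [IsProbabilityMeasure μ] {s n Δ : ℕ} {ε : ℝ} (hε : 0 < ε) (hk : 1 ≤ k) (hd : D + 1 = d)
    (hn : k ≤ n) (hΔ : k ≤ Δ) (A : RowArrivalAlgorithm Ω d k s)
    (hA : ∀ stream : List (EuclideanSpace ℝ (Fin d)), stream.length ≤ n →
      HasIntegerEntries Δ stream → A.SucceedsOn μ ε stream) :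
    0.04 * ((k : ℝ) * D) ≤ s := by
  have : NeZero k := ⟨by omega⟩
  let e : Fin d ≃ Option (Fin D) := Fintype.equivOfCardEq (by simp [hd])
  have h := A.le_of_reduction μ (ε := ε) (Q := Unit) (J := Fin k × Fin D) Finset.univ
    (by
      rw [Finset.card_univ, Fintype.card_fun, Fintype.card_bool, Nat.cast_pow, Nat.cast_ofNat,
        ← Real.rpow_natCast]
      refine Real.rpow_le_rpow_of_exponent_le (by norm_num) ?_
      have : (0 : ℝ) ≤ (Fintype.card (Unit × (Fin k × Fin D)) : ℝ) := by positivity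
      linarith)
    (bitPoints e) (fun _ => []) k (fun x => by simp [bitPoints])
    (fun _ c j => bit (rest e (c (nearestOffset e c ((j.1 : ℕ) : ℝ))) j.2))
    (fun x _ _ => by
      rw [List.append_nil]
      refine hA _ (by simpa [bitPoints] using hn) fun a ha l => ?_
      obtain ⟨g, rfl⟩ := mem_pointList.1 ha
      exact exists_int_lift e (exists_int_natCast (g.2.le.trans hΔ))
        (fun l => exists_int_sign (hk.trans hΔ) _) l)
    (fun x _ _ c hc => by
      rw [List.append_nil] at hc
      have hc0 : cost (bitPoints e x) c ≤ 0 :=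
        hc.trans (mul_nonpos_of_nonneg_of_nonpos (by linarith) (opt_bitPoints_nonpos e x))
      have : ∀ j : Fin k × Fin D,
          bit (rest e (c (nearestOffset e c ((j.1 : ℕ) : ℝ))) j.2) = x ((), j) := by
        intro j
        rw [rest_eq_of_cost_nonpos e x c hc0, bit_sign]
      simp only [this, ne_eq, not_true_eq_false, Finset.filter_false, Finset.card_empty,
        Nat.cast_zero]
      positivity)
  simpa using h

end LargeAccuracy

/-! ### Geometry of the code rows and separation by offsets. -/

section Rows

variable {r D : ℕ}

/-- The vector with `R` in the `i`-th of the first `r` coordinates and `b` in the others. -/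
def row (R : ℝ) (i : Fin r) (b : Fin D → ℝ) : EuclideanSpace ℝ (Fin r ⊕ Fin D) :=
  WithLp.toLp 2 (Sum.elim (fun j => if j = i then R else 0) b)

lemma norm_row_sq (R : ℝ) (i : Fin r) (b : Fin D → ℝ) :
    ‖row R i b‖ ^ 2 = R ^ 2 + ∑ l, b l ^ 2 := by
  rw [EuclideanSpace.real_norm_sq_eq, Fintype.sum_sum_type]
  simp [row, ite_pow]

lemma inner_row_zero (R : ℝ) (i j : Fin r) (b : Fin D → ℝ) :
    inner ℝ (row R j b) (row R i (0 : Fin D → ℝ)) = if j = i then R ^ 2 else 0 := by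
  rw [PiLp.inner_apply, Fintype.sum_sum_type]
  by_cases h : j = i
  · simp [row, h, sq]
  · simp [row, h]

lemma norm_sum_row_sq (R : ℝ) (S : Finset (Fin r)) (b : Fin r → Fin D → ℝ) :
    ‖∑ j ∈ S, row R j (b j)‖ ^ 2 = R ^ 2 * S.card + ∑ l, (∑ j ∈ S, b j l) ^ 2 := by
  rw [EuclideanSpace.real_norm_sq_eq, Fintype.sum_sum_type]
  congr 1
  · simp [row, ite_pow, mul_comm]
  · simp [row]

/-- The mean of `row R i b` and two copies of `row R i 0`. -/
def pairMean (R : ℝ) (i : Fin r) (b : Fin D → ℝ) : EuclideanSpace ℝ (Fin r ⊕ Fin D) :=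
  (3 : ℝ)⁻¹ • (row R i b + (2 : ℝ) • row R i 0)

lemma pairMean_eq (R : ℝ) (i : Fin r) (b : Fin D → ℝ) :
    pairMean R i b = row R i fun l => 3⁻¹ * b l := by
  ext l
  rcases l with j | l
  · by_cases h : j = i
    · simp [pairMean, row, h]
      ring
    · simp [pairMean, row, h]
  · simp [pairMean, row]

lemma norm_row_sub_row_sq (R : ℝ) (i : Fin r) (b b' : Fin D → ℝ) :
    ‖row R i b - row R i b'‖ ^ 2 = ∑ l, (b l - b' l) ^ 2 := by
  rw [EuclideanSpace.real_norm_sq_eq, Fintype.sum_sum_type]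
  simp [row]

lemma exists_int_row {Δ R : ℕ} (hR : R ≤ Δ) (i : Fin r) {b : Fin D → ℝ}
    (hb : ∀ l, ∃ z : ℤ, |z| ≤ (Δ : ℤ) ∧ b l = z) (l : Fin r ⊕ Fin D) :
    ∃ z : ℤ, |z| ≤ (Δ : ℤ) ∧ row (R : ℝ) i b l = z := by
  rcases l with j | l
  · by_cases h : j = i
    · simpa [row, h] using exists_int_natCast hR
    · exact ⟨0, by simp, by simp [row, h]⟩
  · exact hb l

/-- Centers of disjoint intervals of offsets are different. -/
lemma sum_card_le_of_offset {N κ : Type*} [Fintype N] [Fintype κ] [DecidableEq κ] (o : N → ℕ)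
    (ho : Function.Injective o) (L : ℝ) (off : κ → ℝ) (Im : N → Finset κ)
    (h : ∀ n, ∀ y ∈ Im n, 4 * (L * o n - off y) ^ 2 < L ^ 2) :
    ∑ n, (Im n).card ≤ Fintype.card κ := by
  rw [← Finset.card_biUnion, ← Finset.card_univ]
  · exact Finset.card_le_card (Finset.subset_univ _)
  · intro n _ n' _ hne
    refine Finset.disjoint_left.2 fun y hy hy' => hne (ho ?_)
    have h1 := h n y hy
    have h2 := h n' y hy'
    by_contra hne'
    have h3 : (1 : ℝ) ≤ ((o n : ℝ) - o n') ^ 2 := by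
      have : (1 : ℤ) ≤ ((o n : ℤ) - o n') ^ 2 := by
        have : (o n : ℤ) - o n' ≠ 0 := fun h => hne' (by omega)
        have := sq_nonneg ((o n : ℤ) - o n')
        have := pow_ne_zero 2 ‹(o n : ℤ) - o n' ≠ 0›
        omega
      exact_mod_cast this
    have h4 : L ^ 2 * 1 ≤ L ^ 2 * ((o n : ℝ) - o n') ^ 2 :=
      mul_le_mul_of_nonneg_left h3 (sq_nonneg L)
    nlinarith [sq_nonneg ((L * o n - off y) + (L * o n' - off y))]

end Rows

/-! ### The hard instance and its planted cost. -/

section Instance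

variable {d G r D m : ℕ}

/-- The part of the hard instance that is determined by the bits. -/
def codeRows (e : Fin d ≃ Option (Fin r ⊕ Fin D)) (L R : ℕ)
    (x : Fin r × (Fin G × Fin D) → Bool) : List (EuclideanSpace ℝ (Fin d)) :=
  pointList fun q : Fin G × Fin r =>
    lift e ((L * (q.1 : ℕ) : ℕ) : ℝ) (row R q.2 fun l => sign (x (q.2, (q.1, l))))

/-- The part of the hard instance that is determined by the query: in every group two copies of
the query point and `Z` anchors, and `m` isolated points. -/
def queryRows (e : Fin d ≃ Option (Fin r ⊕ Fin D)) (G m L R Z : ℕ) (i : Fin r) :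
    List (EuclideanSpace ℝ (Fin d)) :=
  pointList (fun q : Fin G × Fin 2 =>
      lift e ((L * (q.1 : ℕ) : ℕ) : ℝ) (row R i (0 : Fin D → ℝ))) ++
    (pointList (fun q : Fin G × Fin Z => lift e ((L * (q.1 : ℕ) : ℕ) : ℝ) 0) ++
      pointList (fun t : Fin m => lift e ((L * (G + t) : ℕ) : ℝ) 0))

lemma length_codeRows (e : Fin d ≃ Option (Fin r ⊕ Fin D)) (L R : ℕ)
    (x : Fin r × (Fin G × Fin D) → Bool) : (codeRows e L R x).length = G * r := by
  simp [codeRows]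

lemma length_queryRows (e : Fin d ≃ Option (Fin r ⊕ Fin D)) (L R Z : ℕ) (i : Fin r) :
    (queryRows e G m L R Z i).length = G * 2 + (G * Z + m) := by
  simp [queryRows]

lemma cost_instance {k : ℕ} (e : Fin d ≃ Option (Fin r ⊕ Fin D)) (L R Z : ℕ)
    (x : Fin r × (Fin G × Fin D) → Bool) (i : Fin r) (c : Fin k → EuclideanSpace ℝ (Fin d)) :
    cost (codeRows e L R x ++ queryRows e G m L R Z i) c
      = ∑ g : Fin G, ((∑ j : Fin r, ⨅ y, ‖lift e ((L * (g : ℕ) : ℕ) : ℝ)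
            (row R j fun l => sign (x (j, (g, l)))) - c y‖ ^ 2)
          + 2 * (⨅ y, ‖lift e ((L * (g : ℕ) : ℕ) : ℝ) (row R i (0 : Fin D → ℝ)) - c y‖ ^ 2)
          + Z * (⨅ y, ‖lift e ((L * (g : ℕ) : ℕ) : ℝ) 0 - c y‖ ^ 2))
        + ∑ t : Fin m, ⨅ y, ‖lift e ((L * (G + t) : ℕ) : ℝ) 0 - c y‖ ^ 2 := by
  rw [cost_append, codeRows, queryRows, cost_append, cost_append]
  simp only [cost_pointList, Fintype.sum_prod_type, Finset.sum_const, Finset.card_univ,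
    Fintype.card_fin, nsmul_eq_mul, Finset.sum_add_distrib]
  push_cast
  ring

lemma hasIntegerEntries_instance {Δ L R Z : ℕ} (e : Fin d ≃ Option (Fin r ⊕ Fin D))
    (hΔ : 1 ≤ Δ) (hL : L * (G + m) ≤ Δ) (hR : R ≤ Δ)
    (x : Fin r × (Fin G × Fin D) → Bool) (i : Fin r) :
    HasIntegerEntries Δ (codeRows e L R x ++ queryRows e G m L R Z i) := by
  have hg : ∀ g : Fin G, L * (g : ℕ) ≤ Δ := fun g =>
    (Nat.mul_le_mul_left L (by omega)).trans hL
  have h0 : ∃ z : ℤ, |z| ≤ (Δ : ℤ) ∧ (0 : ℝ) = z := ⟨0, by simp, by simp⟩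
  intro a ha l
  rw [queryRows, List.mem_append, List.mem_append, List.mem_append] at ha
  rcases ha with ha | ha | ha | ha <;> obtain ⟨q, rfl⟩ := mem_pointList.1 ha
  · exact exists_int_lift e (exists_int_natCast (hg _))
      (exists_int_row hR _ fun _ => exists_int_sign hΔ _) l
  · exact exists_int_lift e (exists_int_natCast (hg _)) (exists_int_row hR _ fun _ => h0) l
  · exact exists_int_lift e (exists_int_natCast (hg _)) (fun _ => h0) l
  · exact exists_int_lift e (exists_int_natCast ((Nat.mul_le_mul_left L (by omega)).trans hL))
      (fun _ => h0) l

/-- The cost of the planted clustering. -/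
lemma opt_instance_le {k : ℕ} (e : Fin d ≃ Option (Fin r ⊕ Fin D)) (hk : k = 2 * G + m)
    (L R Z : ℕ) (x : Fin r × (Fin G × Fin D) → Bool) (i : Fin r) :
    opt k (codeRows e L R x ++ queryRows e G m L R Z i)
      ≤ G * ((r - 1) * ((R : ℝ) ^ 2 + D) + 2 / 3 * D) := by
  let E : (Fin G ⊕ Fin G) ⊕ Fin m ≃ Fin k := Fintype.equivOfCardEq (by simp [hk, two_mul])
  let h : (Fin G ⊕ Fin G) ⊕ Fin m → EuclideanSpace ℝ (Fin d) :=
    Sum.elim (Sum.elim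
      (fun g => lift e ((L * (g : ℕ) : ℕ) : ℝ) (pairMean R i fun l => sign (x (i, (g, l)))))
      (fun g => lift e ((L * (g : ℕ) : ℕ) : ℝ) 0))
      (fun t => lift e ((L * (G + t) : ℕ) : ℝ) 0)
  have hle : ∀ a y, (⨅ z, ‖a - (h ∘ E.symm) z‖ ^ 2) ≤ ‖a - h y‖ ^ 2 := by
    intro a y
    have := iInf_le_dist a (h ∘ E.symm) (E y)
    rwa [Function.comp_apply, E.symm_apply_apply] at this
  refine (opt_le_cost _ (h ∘ E.symm)).trans ?_
  rw [cost_instance]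
  have h1 : ∑ t : Fin m, (⨅ y, ‖lift e ((L * (G + t) : ℕ) : ℝ) 0 - (h ∘ E.symm) y‖ ^ 2) ≤ 0 :=
    Finset.sum_nonpos fun t _ => (hle _ (Sum.inr t)).trans (by simp [h])
  have h2 : ∀ g : Fin G, ((∑ j : Fin r, ⨅ y, ‖lift e ((L * (g : ℕ) : ℕ) : ℝ)
            (row R j fun l => sign (x (j, (g, l)))) - (h ∘ E.symm) y‖ ^ 2)
          + 2 * (⨅ y, ‖lift e ((L * (g : ℕ) : ℕ) : ℝ) (row R i (0 : Fin D → ℝ))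
              - (h ∘ E.symm) y‖ ^ 2)
          + Z * (⨅ y, ‖lift e ((L * (g : ℕ) : ℕ) : ℝ) 0 - (h ∘ E.symm) y‖ ^ 2))
      ≤ (r - 1) * ((R : ℝ) ^ 2 + D) + 2 / 3 * D := by
    intro g
    have ha : ∑ j : Fin r, (⨅ y, ‖lift e ((L * (g : ℕ) : ℕ) : ℝ)
            (row R j fun l => sign (x (j, (g, l)))) - (h ∘ E.symm) y‖ ^ 2)
        ≤ 4 / 9 * D + (r - 1) * ((R : ℝ) ^ 2 + D) := by
      rw [← Finset.add_sum_erase _ _ (Finset.mem_univ i)]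
      refine add_le_add ((hle _ (Sum.inl (Sum.inl g))).trans (le_of_eq ?_)) ?_
      · simp only [h, Sum.elim_inl, norm_lift_sub_sq, offset_lift, rest_lift, pairMean_eq,
          norm_row_sub_row_sq]
        have : ∀ l : Fin D, (sign (x (i, (g, l))) - 3⁻¹ * sign (x (i, (g, l)))) ^ 2 = 4 / 9 := by
          intro l
          rw [← one_sub_mul, mul_pow, sign_sq]
          norm_num
        simp_rw [this]
        simp
        ring
      · have h3 : ∀ j ∈ (Finset.univ : Finset (Fin r)).erase i,
            (⨅ y, ‖lift e ((L * (g : ℕ) : ℕ) : ℝ)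
              (row R j fun l => sign (x (j, (g, l)))) - (h ∘ E.symm) y‖ ^ 2)
            ≤ (R : ℝ) ^ 2 + D := by
          intro j _
          refine (hle _ (Sum.inl (Sum.inr g))).trans (le_of_eq ?_)
          simp [h, norm_lift_sub_sq, norm_row_sq]
        refine (Finset.sum_le_card_nsmul _ _ _ h3).trans (le_of_eq ?_)
        rw [Finset.card_erase_of_mem (Finset.mem_univ i), Finset.card_univ, Fintype.card_fin,
          nsmul_eq_mul, Nat.cast_sub (Fin.pos i), Nat.cast_one]
    have hb : (⨅ y, ‖lift e ((L * (g : ℕ) : ℕ) : ℝ) (row R i (0 : Fin D → ℝ))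
              - (h ∘ E.symm) y‖ ^ 2) ≤ 1 / 9 * D := by
      refine (hle _ (Sum.inl (Sum.inl g))).trans (le_of_eq ?_)
      simp only [h, Sum.elim_inl, norm_lift_sub_sq, offset_lift, rest_lift, pairMean_eq,
        norm_row_sub_row_sq]
      have : ∀ l : Fin D, ((0 : Fin D → ℝ) l - 3⁻¹ * sign (x (i, (g, l)))) ^ 2 = 1 / 9 := by
        intro l
        rw [Pi.zero_apply, zero_sub, neg_sq, mul_pow, sign_sq]
        norm_num
      simp_rw [this]
      simp
      ring
    have hc : (Z : ℝ) * (⨅ y, ‖lift e ((L * (g : ℕ) : ℕ) : ℝ) 0 - (h ∘ E.symm) y‖ ^ 2) ≤ 0 :=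
      mul_nonpos_of_nonneg_of_nonpos (by positivity)
        ((hle _ (Sum.inl (Sum.inr g))).trans (by simp [h]))
    -- Here `4/9 D` from the code point and `2 · 1/9 D` from the query copies make `2/3 D`.
    linarith
  have h3 := Finset.sum_le_card_nsmul Finset.univ _ _ fun g _ => h2 g
  rw [Finset.card_univ, Fintype.card_fin, nsmul_eq_mul] at h3
  linarith

end Instance

/-! ### Decoding bits from nearly optimal centers. -/

section Decoding

variable {d G r D m : ℕ}

/-- The bits read off the centers that are nearest to the query points. -/
def decodeRows {k : ℕ} [NeZero k] (e : Fin d ≃ Option (Fin r ⊕ Fin D)) (L R : ℕ) (i : Fin r)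
    (c : Fin k → EuclideanSpace ℝ (Fin d)) (q : Fin G × Fin D) : Bool :=
  bit (rest e (c (nearest c (lift e ((L * (q.1 : ℕ) : ℕ) : ℝ) (row R i (0 : Fin D → ℝ)))))
    (Sum.inr q.2))

/-- Each wrong bit contributes at least `1/9` to the squared distance. -/
lemma card_bit_ne_le (R : ℝ) (i : Fin r) (b : Fin D → Bool)
    (y : EuclideanSpace ℝ (Fin r ⊕ Fin D)) :
    ((Finset.univ.filter fun l => bit (y (Sum.inr l)) ≠ b l).card : ℝ)
      ≤ 9 * ‖y - pairMean R i fun l => sign (b l)‖ ^ 2 := by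
  rw [pairMean_eq, EuclideanSpace.real_norm_sq_eq, Fintype.sum_sum_type]
  have h1 : ((Finset.univ.filter fun l => bit (y (Sum.inr l)) ≠ b l).card : ℝ)
      ≤ ∑ l, 9 * (y (Sum.inr l) - 3⁻¹ * sign (b l)) ^ 2 := by
    rw [Finset.card_filter]
    push_cast
    refine Finset.sum_le_sum fun l _ => ?_
    split_ifs with h
    · have := le_sq_of_bit_ne h
      linarith
    · positivity
  rw [← Finset.mul_sum] at h1
  refine h1.trans ?_
  refine mul_le_mul_of_nonneg_left ?_ (by norm_num)
  have : (0 : ℝ) ≤ ∑ j : Fin r, ((y - row R i fun l => 3⁻¹ * sign (b l)) (Sum.inl j)) ^ 2 :=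
    Finset.sum_nonneg fun _ _ => sq_nonneg _
  simp only [row, PiLp.sub_apply, Sum.elim_inr] at this ⊢
  linarith

/-- Nearly optimal centers of the hard instance determine most of the bits queried. -/
lemma card_decodeRows_ne_le {k : ℕ} [NeZero k] (e : Fin d ≃ Option (Fin r ⊕ Fin D))
    (hk : k = 2 * G + m) {R L Z : ℕ} {ε : ℝ} (hD : 1 ≤ D) (hr : 1 ≤ r)
    (hR : (32 : ℝ) * D ≤ (R : ℝ) ^ 2) (hR' : (R : ℝ) ^ 2 ≤ 66 * D) (hε : 0 < ε) (hε1 : ε < 1)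
    (hεr : ε * r ≤ 1 / 20000) (hZ : Z = 200000 * r) (hL : L = 536 * (G * (r * D)))
    (x : Fin r × (Fin G × Fin D) → Bool)
    (hx : ∀ g, ∀ S : Finset (Fin r),
      ∑ l, (∑ j ∈ S, sign (x (j, (g, l)))) ^ 2 ≤ 8 * D * S.card)
    (i : Fin r) (c : Fin k → EuclideanSpace ℝ (Fin d))
    (hc : IsApproxOptimal ε (codeRows e L R x ++ queryRows e G m L R Z i) c) :
    ((Finset.univ.filter fun q => decodeRows e L R i c q ≠ x (i, q)).card : ℝ)
      ≤ Fintype.card (Fin G × Fin D) / 40 := by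
  rcases Nat.eq_zero_or_pos G with hG0 | hG
  · subst hG0
    simp
  have hD' : (1 : ℝ) ≤ D := by exact_mod_cast hD
  have hr' : (1 : ℝ) ≤ r := by exact_mod_cast hr
  have hG' : (1 : ℝ) ≤ G := by exact_mod_cast hG
  set base : ℝ := (r - 1) * ((R : ℝ) ^ 2 + D) + 2 / 3 * D with hbase
  have hbase0 : 0 ≤ base := by
    have : 0 ≤ ((r : ℝ) - 1) * ((R : ℝ) ^ 2 + D) := mul_nonneg (by linarith) (by positivity)
    have : 0 ≤ 2 / 3 * (D : ℝ) := by positivity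
    linarith
  have hbase1 : base ≤ 67 * (r * D) := by
    have : ((r : ℝ) - 1) * ((R : ℝ) ^ 2 + D) ≤ (r - 1) * (67 * D) :=
      mul_le_mul_of_nonneg_left (by linarith) (by linarith)
    nlinarith
  let F : Fin G → Fin r → Fin k := fun g j =>
    nearest c (lift e ((L * (g : ℕ) : ℕ) : ℝ) (row R j fun l => sign (x (j, (g, l)))))
  let P : Fin G → Fin k := fun g =>
    nearest c (lift e ((L * (g : ℕ) : ℕ) : ℝ) (row R i (0 : Fin D → ℝ)))
  let A : Fin G → Fin k := fun g => nearest c (lift e ((L * (g : ℕ) : ℕ) : ℝ) 0)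
  let T : Fin m → Fin k := fun t => nearest c (lift e ((L * (G + t) : ℕ) : ℝ) 0)
  let K : Fin G → ℝ := fun g =>
    (∑ j, ‖lift e ((L * (g : ℕ) : ℕ) : ℝ) (row R j fun l => sign (x (j, (g, l))))
        - c (F g j)‖ ^ 2)
      + 2 * ‖lift e ((L * (g : ℕ) : ℕ) : ℝ) (row R i (0 : Fin D → ℝ)) - c (P g)‖ ^ 2
      + Z * ‖lift e ((L * (g : ℕ) : ℕ) : ℝ) 0 - c (A g)‖ ^ 2
  let U : Fin m → ℝ := fun t => ‖lift e ((L * (G + t) : ℕ) : ℝ) 0 - c (T t)‖ ^ 2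
  have hcost : ∑ g, K g + ∑ t, U t ≤ (1 + ε) * (G * base) := by
    have h1 : cost (codeRows e L R x ++ queryRows e G m L R Z i) c = ∑ g, K g + ∑ t, U t := by
      rw [cost_instance]
      simp only [iInf_eq_nearest]
      rfl
    rw [← h1]
    exact hc.trans (mul_le_mul_of_nonneg_left (opt_instance_le e hk L R Z x i) (by linarith))
  have hK0 : ∀ g, 0 ≤ K g := fun g => by positivity
  have hU0 : ∀ t, 0 ≤ U t := fun t => by positivity
  -- The cost is at most `2 · 67 · GrD`, and `536 = 4 · 2 · 67`. Thus every point lies within `L /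
  -- 2` of its center in offset.
  have hsmall : 4 * ((1 + ε) * (G * base)) < (L : ℝ) ^ 2 := by
    have h1 : (1 : ℝ) ≤ G * (r * D) := one_le_mul_of_one_le_of_one_le hG'
      (one_le_mul_of_one_le_of_one_le hr' hD')
    have h2 : (1 + ε) * (G * base) ≤ 2 * (G * (67 * (r * D))) := by gcongr; linarith
    rw [hL]
    push_cast
    nlinarith
  have hKle : ∀ g, 4 * K g < (L : ℝ) ^ 2 := fun g => by
    have h1 := Finset.single_le_sum (fun g _ => hK0 g) (Finset.mem_univ g)
    have h2 := Finset.sum_nonneg fun t (_ : t ∈ Finset.univ) => hU0 t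
    linarith
  have hUle : ∀ t, 4 * U t < (L : ℝ) ^ 2 := fun t => by
    have h1 := Finset.single_le_sum (fun t _ => hU0 t) (Finset.mem_univ t)
    have h2 := Finset.sum_nonneg fun g (_ : g ∈ Finset.univ) => hK0 g
    linarith
  have hoffset : ∀ (t : ℝ) v y, (t - offset e (c y)) ^ 2 ≤ ‖lift e t v - c y‖ ^ 2 := by
    intro t v y
    rw [norm_lift_sub_sq]
    have := sq_nonneg ‖v - rest e (c y)‖
    linarith
  let Im : Fin G → Finset (Fin k) := fun g =>
    insert (P g) (insert (A g) (Finset.univ.image (F g)))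
  have hZ1 : (1 : ℝ) ≤ Z := by
    rw [hZ]
    push_cast
    linarith
  -- The offset intervals are disjoint and the isolated points use up `m` of the `2 G + m` centers.
  have hcard : ∑ g, ((Im g).card : ℝ) ≤ 2 * G := by
    have h1 := sum_card_le_of_offset
      (Sum.elim (fun g : Fin G => (g : ℕ)) (fun t : Fin m => G + t))
      (by
        rintro (g | t) (g' | t') h <;> simp only [Sum.elim_inl, Sum.elim_inr] at h
        · rw [Fin.ext h]
        · omega
        · omega
        · rw [Fin.ext (Nat.add_left_cancel h)])
      (L : ℝ) (fun y => offset e (c y)) (Sum.elim Im fun t => {T t}) (by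
        rintro (g | t) y hy
        · have hj := Finset.sum_nonneg fun j (_ : j ∈ (Finset.univ : Finset (Fin r))) =>
            sq_nonneg ‖lift e ((L * (g : ℕ) : ℕ) : ℝ) (row R j fun l => sign (x (j, (g, l))))
              - c (F g j)‖
          have hPg : 0 ≤ ‖lift e ((L * (g : ℕ) : ℕ) : ℝ) (row R i (0 : Fin D → ℝ))
            - c (P g)‖ ^ 2 := by positivity
          have hAg : 0 ≤ ‖lift e ((L * (g : ℕ) : ℕ) : ℝ) 0 - c (A g)‖ ^ 2 := by positivity
          have hZA : 1 * ‖lift e ((L * (g : ℕ) : ℕ) : ℝ) 0 - c (A g)‖ ^ 2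
            ≤ Z * ‖lift e ((L * (g : ℕ) : ℕ) : ℝ) 0 - c (A g)‖ ^ 2 := by gcongr
          have hKg := hKle g
          simp only [K] at hKg
          simp only [Sum.elim_inl, Im, Finset.mem_insert, Finset.mem_image, Finset.mem_univ,
            true_and] at hy ⊢
          rw [← Nat.cast_mul]
          rcases hy with rfl | rfl | ⟨j, rfl⟩
          · have := hoffset ((L * (g : ℕ) : ℕ) : ℝ) (row R i (0 : Fin D → ℝ)) (P g)
            linarith
          · have := hoffset ((L * (g : ℕ) : ℕ) : ℝ) (0) (A g)
            linarith
          · have hj' := Finset.single_le_sum (f := fun j => ‖lift e ((L * (g : ℕ) : ℕ) : ℝ)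
                (row R j fun l => sign (x (j, (g, l)))) - c (F g j)‖ ^ 2)
              (fun j _ => sq_nonneg _) (Finset.mem_univ j)
            refine lt_of_le_of_lt (mul_le_mul_of_nonneg_left (hoffset _ _ _)
              (by norm_num)) (lt_of_le_of_lt (mul_le_mul_of_nonneg_left hj' (by norm_num))
                (lt_of_le_of_lt ?_ hKg))
            linarith
        · simp only [Sum.elim_inr, Finset.mem_singleton] at hy ⊢
          subst hy
          rw [← Nat.cast_mul]
          exact lt_of_le_of_lt (mul_le_mul_of_nonneg_left (hoffset _ _ _)
            (by norm_num)) (hUle t))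
    simp only [Fintype.sum_sum_type, Sum.elim_inl, Sum.elim_inr, Finset.card_singleton,
      Finset.sum_const, Finset.card_univ, Fintype.card_fin, smul_eq_mul, mul_one] at h1
    have h2 : ∑ g, (Im g).card ≤ 2 * G := by omega
    exact_mod_cast h2
  set lam : ℝ := (R : ℝ) ^ 2 + 8 * D with hlam
  let defect : Fin G → ℝ := fun g =>
    ∑ j, ‖row (R : ℝ) j (fun l => sign (x (j, (g, l)))) - rest e (c (F g j))‖ ^ 2
      + 2 * ‖row (R : ℝ) i (0 : Fin D → ℝ) - rest e (c (P g))‖ ^ 2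
      + Z * ‖rest e (c (A g))‖ ^ 2 + lam * ((Im g).card : ℝ) - base - 2 * lam
      + 10 * lam * r / Z
  have hwrong : ∀ g, ((Finset.univ.filter fun l =>
      decodeRows e L R i c (g, l) ≠ x (i, (g, l))).card : ℝ) ≤ 3 * defect g := by
    intro g
    rcases group_stability (fun j => row (R : ℝ) j fun l => sign (x (j, (g, l))))
      (row (R : ℝ) i 0) i (R2 := (R : ℝ) ^ 2) (D := D) (Z := Z) (lam := lam) (by positivity) hR
      hlam (by linarith)
      (fun S => by
        rw [norm_sum_row_sq (R : ℝ) S fun j l => sign (x (j, (g, l)))]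
        have := hx g S
        rw [hlam]
        linarith)
      (by simp [norm_row_sq]) (by simp [inner_row_zero])
      (fun j hj => by rw [inner_row_zero, if_neg hj])
      (fun j => by simp [norm_row_sq])
      (fun y => rest e (c y)) (F g) (P g) (A g) (defect g) rfl with h | h
    · have h1 := Finset.card_le_univ (Finset.univ.filter fun l =>
        decodeRows e L R i c (g, l) ≠ x (i, (g, l)))
      rw [Fintype.card_fin] at h1
      have h2 : ((Finset.univ.filter fun l =>
        decodeRows e L R i c (g, l) ≠ x (i, (g, l))).card : ℝ) ≤ D := by exact_mod_cast h1
      linarith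
    · have h1 := card_bit_ne_le (R : ℝ) i (fun l => x (i, (g, l))) (rest e (c (P g)))
      refine h1.trans ?_
      simp only [pairMean]
      linarith
  have hKrest : ∀ g, ∑ j, ‖row (R : ℝ) j (fun l => sign (x (j, (g, l))))
        - rest e (c (F g j))‖ ^ 2
      + 2 * ‖row (R : ℝ) i (0 : Fin D → ℝ) - rest e (c (P g))‖ ^ 2
      + Z * ‖rest e (c (A g))‖ ^ 2 ≤ K g := by
    intro g
    have h1 : ∀ (t : ℝ) v y, ‖v - rest e (c y)‖ ^ 2 ≤ ‖lift e t v - c y‖ ^ 2 := by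
      intro t v y
      rw [norm_lift_sub_sq]
      have := sq_nonneg (t - offset e (c y))
      linarith
    have h2 : ‖rest e (c (A g))‖ ^ 2
        ≤ ‖lift e ((L * (g : ℕ) : ℕ) : ℝ) 0 - c (A g)‖ ^ 2 := by
      have := h1 ((L * (g : ℕ) : ℕ) : ℝ) 0 (A g)
      rwa [zero_sub, norm_neg] at this
    exact add_le_add (add_le_add (Finset.sum_le_sum fun j _ => h1 _ _ _)
      (mul_le_mul_of_nonneg_left (h1 _ _ _) (by norm_num)))
      (mul_le_mul_of_nonneg_left h2 (by positivity))
  have hτ : 10 * lam * r / Z = lam / 20000 := by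
    rw [hZ]
    push_cast
    field_simp
    ring
  -- Per group, the approximation error gives `67/20000 D` and the anchors `74/20000 D`; together
  -- they stay below `D / 120`. The factor 3 in `hwrong` turns this into the error rate `1/40`.
  have hdefect : ∑ g, defect g ≤ G * (D / 120) := by
    have h1 : ∀ g, defect g ≤ K g + lam * ((Im g).card : ℝ) - base - 2 * lam + lam / 20000 := by
      intro g
      have := hKrest g
      simp only [defect, hτ]
      linarith
    have h2 := Finset.sum_le_sum fun g (_ : g ∈ Finset.univ) => h1 g
    simp only [Finset.sum_add_distrib, Finset.sum_sub_distrib, Finset.sum_const,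
      Finset.card_univ, Fintype.card_fin, nsmul_eq_mul, ← Finset.mul_sum] at h2
    have h3 := Finset.sum_nonneg fun t (_ : t ∈ Finset.univ) => hU0 t
    have h4 : lam * ∑ g, ((Im g).card : ℝ) ≤ lam * (2 * G) :=
      mul_le_mul_of_nonneg_left hcard (by positivity)
    have h5 : ε * base ≤ 67 / 20000 * D := by
      calc ε * base ≤ ε * (67 * (r * D)) := mul_le_mul_of_nonneg_left hbase1 hε.le
        _ = 67 * D * (ε * r) := by ring
        _ ≤ 67 * D * (1 / 20000) := by gcongr
        _ = _ := by ring
    have h6 : lam ≤ 74 * D := by linarith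
    have h7 : (G : ℝ) * (ε * base + lam / 20000) ≤ G * (D / 120) := by
      gcongr
      linarith
    linarith
  rw [Finset.card_filter, Fintype.sum_prod_type]
  push_cast
  have h1 : ∀ g : Fin G, (∑ l : Fin D, if decodeRows e L R i c (g, l) ≠ x (i, (g, l))
      then (1 : ℝ) else 0) ≤ 3 * defect g := by
    intro g
    have := hwrong g
    rw [Finset.card_filter] at this
    exact_mod_cast this
  refine (Finset.sum_le_sum fun g _ => h1 g).trans ?_
  rw [← Finset.mul_sum, Fintype.card_prod, Fintype.card_fin, Fintype.card_fin]
  push_cast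
  linarith

end Decoding

/-! ### Choice of parameters and the final bounds. -/

section LowerBound

/-- The messages all of whose groups are sign matrices with short row sums. -/
def messages (r G D : ℕ) : Finset (Fin r × (Fin G × Fin D) → Bool) :=
  (Fintype.piFinset fun _ : Fin G => shortSums r D).image fun y q => y q.2.1 q.2.2 q.1

lemma card_messages (r G D : ℕ) : (messages r G D).card = (shortSums r D).card ^ G := by
  rw [messages, Finset.card_image_of_injective, Fintype.card_piFinset]
  · simp
  · intro y y' h
    ext g l j
    have := congrFun h (j, (g, l))
    simp only at this
    rw [this]

/-- Restricting to short sums loses at most one bit per group, which is at most 1% of its `r D ≥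
100` bits. -/
lemma le_card_messages {r G D : ℕ} (hr : 1 ≤ r) (hrD : r ≤ D) (hD : 100 ≤ D) :
    (2 : ℝ) ^ (0.99 * (Fintype.card (Fin r × (Fin G × Fin D)) : ℝ)) ≤ (messages r G D).card := by
  have h1 := half_le_card_shortSums (by omega : 1 ≤ D) hrD
  have h2 : (2 : ℝ) ^ (r * D) / 2 = (2 : ℝ) ^ ((r : ℝ) * D - 1) := by
    rw [Real.rpow_sub (by norm_num), Real.rpow_one, ← Nat.cast_mul, Real.rpow_natCast]
  have h3 : (100 : ℝ) ≤ r * D := by exact_mod_cast hD.trans (Nat.le_mul_of_pos_left D hr)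
  rw [card_messages]
  push_cast
  refine le_trans ?_ (pow_le_pow_left₀ (by positivity) h1 G)
  rw [h2, ← Real.rpow_natCast, ← Real.rpow_mul (by norm_num)]
  refine Real.rpow_le_rpow_of_exponent_le (by norm_num) ?_
  simp only [Fintype.card_prod, Fintype.card_fin]
  push_cast
  have h4 : (0 : ℝ) ≤ G := by positivity
  nlinarith

/-- The space lower bound in terms of the parameters of the hard instance. -/
lemma le_of_succeedsOn_instance {Ω : Type*} [MeasurableSpace Ω] (μ : Measure Ω)
    [IsProbabilityMeasure μ] {d k s n Δ r G D m R : ℕ} {ε : ℝ} (hε : 0 < ε) (hε1 : ε < 1)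
    (hd : d = D + 1 + r) (hk0 : 1 ≤ k) (hk : k = 2 * G + m) (hr : 1 ≤ r) (hrD : r ≤ D)
    (hD : 100 ≤ D) (hεr : ε * r ≤ 1 / 20000) (hR : (32 : ℝ) * D ≤ (R : ℝ) ^ 2)
    (hR' : (R : ℝ) ^ 2 ≤ 66 * D)
    (hn : G * r + (G * 2 + (G * (200000 * r) + m)) ≤ n)
    (hΔ : 536 * (G * (r * D)) * (G + m) ≤ Δ) (hRΔ : R ≤ Δ) (hΔ1 : 1 ≤ Δ)
    (A : RowArrivalAlgorithm Ω d k s)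
    (hA : ∀ stream : List (EuclideanSpace ℝ (Fin d)), stream.length ≤ n →
      HasIntegerEntries Δ stream → A.SucceedsOn μ ε stream) :
    0.04 * ((r : ℝ) * (G * D)) ≤ s := by
  have : NeZero k := ⟨by omega⟩
  let e : Fin d ≃ Option (Fin r ⊕ Fin D) := Fintype.equivOfCardEq (by simp [hd]; omega)
  have h := A.le_of_reduction μ (messages r G D) (le_card_messages hr hrD hD)
    (codeRows e (536 * (G * (r * D))) R)
    (queryRows e G m (536 * (G * (r * D))) R (200000 * r)) (G * r)
    (fun x => length_codeRows e _ _ x) (decodeRows e (536 * (G * (r * D))) R)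
    (fun x _ i => hA _ (by rwa [List.length_append, length_codeRows, length_queryRows])
      (hasIntegerEntries_instance e hΔ1 hΔ hRΔ x i))
    (fun x hx i c hc => card_decodeRows_ne_le e hk (by omega) hr hR hR' hε hε1 hεr rfl rfl x
      (by
        obtain ⟨y, hy, rfl⟩ := Finset.mem_image.1 hx
        intro g
        exact (Finset.mem_filter.1 (Fintype.mem_piFinset.1 hy g)).2)
      i c hc)
  simpa using h

lemma exists_sq_between {D : ℕ} (hD : 1 ≤ D) :
    ∃ R : ℕ, (32 : ℝ) * D ≤ (R : ℝ) ^ 2 ∧ (R : ℝ) ^ 2 ≤ 66 * D := by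
  refine ⟨Nat.sqrt (32 * D) + 1, ?_, ?_⟩
  · have := Nat.lt_succ_sqrt' (32 * D)
    exact_mod_cast this.le
  · have h1 := Nat.sqrt_le' (32 * D)
    have h2 : (Nat.sqrt (32 * D) + 1) ^ 2 ≤ 66 * D := by
      nlinarith [sq_nonneg ((Nat.sqrt (32 * D) : ℤ) - 1)]
    exact_mod_cast h2

/-- The space lower bound for small `ε`. -/
lemma le_of_succeedsOn_of_le {Ω : Type*} [MeasurableSpace Ω] (μ : Measure Ω)
    [IsProbabilityMeasure μ] {d k s n Δ : ℕ} {ε : ℝ} (hε : 0 < ε) (hε1 : ε ≤ 1 / 20000)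
    (hk : 2 ≤ k) (hd : 1 / ε ≤ (d : ℝ)) (hn : 20 * (k / ε) ≤ (n : ℝ))
    (hΔ : ((d : ℝ) * k / ε) ^ 3 ≤ (Δ : ℝ)) (A : RowArrivalAlgorithm Ω d k s)
    (hA : ∀ stream : List (EuclideanSpace ℝ (Fin d)), stream.length ≤ n →
      HasIntegerEntries Δ stream → A.SucceedsOn μ ε stream) :
    1 / 10000000 * ((d : ℝ) * k / ε) ≤ s := by
  set q : ℝ := 1 / ε with hq
  have hεq : ε * q = 1 := by rw [hq]; field_simp
  have hq0 : 20000 ≤ q := by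
    rw [hq, le_div_iff₀ hε]
    linarith
  set X : ℝ := (d : ℝ) * k / ε with hX
  have hXq : X = d * k * q := by rw [hX, hq]; ring
  have hkq : (k : ℝ) / ε = k * q := by rw [hq]; ring
  rw [hkq] at hn
  -- The largest `r` with `ε r ≤ 1/20000`; since `q ≥ 20000` it is positive, and rounding loses at
  -- most a factor 2.
  set r : ℕ := ⌊q / 20000⌋₊ with hr
  have hr1 : (r : ℝ) ≤ q / 20000 := Nat.floor_le (by positivity)
  have hr2 : q / 20000 < r + 1 := Nat.lt_floor_add_one _
  have hr3 : 1 ≤ r := Nat.le_floor (by push_cast; linarith)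
  have hr3' : (1 : ℝ) ≤ r := by exact_mod_cast hr3
  have hr4 : q ≤ 40000 * r := by linarith
  have hdr : 20000 * r ≤ d := by
    have : (20000 : ℝ) * r ≤ d := by linarith
    exact_mod_cast this
  obtain ⟨D, hD⟩ : ∃ D, d = D + 1 + r := ⟨d - 1 - r, by omega⟩
  have hdD : d ≤ 2 * D := by omega
  obtain ⟨R, hR1, hR2⟩ := exists_sq_between (D := D) (by omega)
  have hk' : (2 : ℝ) ≤ k := by exact_mod_cast hk
  have hd' : (20000 : ℝ) ≤ d := hq0.trans hd
  have hdD' : (d : ℝ) ≤ 2 * D := by exact_mod_cast hdD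
  have hDd : (D : ℝ) ≤ d := by exact_mod_cast (by omega : D ≤ d)
  set G := k / 2 with hG
  set m := k % 2 with hm
  have hkG : k = 2 * G + m := (Nat.div_add_mod k 2).symm
  have hGk : (G : ℝ) ≤ k := by exact_mod_cast (by omega : G ≤ k)
  have hGm : ((G + m : ℕ) : ℝ) ≤ k := by exact_mod_cast (by omega : G + m ≤ k)
  have hkG' : (k : ℝ) ≤ 3 * G := by exact_mod_cast (by omega : k ≤ 3 * G)
  have hm' : (m : ℝ) ≤ 1 := by exact_mod_cast (by omega : m ≤ 1)
  have hX1 : 20000 ≤ X := by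
    rw [hXq]
    calc (20000 : ℝ) = 20000 * 1 * 1 := by norm_num
      _ ≤ d * k * q := by gcongr <;> linarith
  have hXk : (k : ℝ) ≤ X := by
    rw [hXq]
    calc (k : ℝ) = 1 * k * 1 := by ring
      _ ≤ d * k * q := by gcongr <;> linarith
  have hXd : (d : ℝ) ≤ X := by
    rw [hXq]
    calc (d : ℝ) = d * 1 * 1 := by ring
      _ ≤ d * k * q := by gcongr <;> linarith
  have hX3 : 20000 * X * X ≤ X ^ 3 := by
    calc 20000 * X * X ≤ X * X * X := by gcongr
      _ = X ^ 3 := by ring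
  have hXX : 20000 * X ≤ 20000 * X * X := le_mul_of_one_le_right (by positivity) (by linarith)
  have hlen : G * r + (G * 2 + (G * (200000 * r) + m)) ≤ n := by
    have h2G : (2 : ℝ) * G ≤ k := by exact_mod_cast (by omega : 2 * G ≤ k)
    have h1 : (G : ℝ) * r + (G * 2 + (G * (200000 * r) + m)) ≤ n := by
      have h2 : (G : ℝ) * r ≤ k * (q / 20000) := by gcongr
      have h3 : (k : ℝ) * 20000 ≤ k * q := by gcongr
      linarith
    exact_mod_cast h1
  have hΔL : 536 * (G * (r * D)) * (G + m) ≤ Δ := by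
    have h1 : (536 : ℝ) * (G * (r * D)) * ((G + m : ℕ) : ℝ) ≤ Δ := by
      calc (536 : ℝ) * (G * (r * D)) * ((G + m : ℕ) : ℝ) ≤ 536 * (k * (q * d)) * X := by
            gcongr
            · linarith
            · exact hGm.trans hXk
        _ = 536 * X * X := by rw [hXq]; ring
        _ ≤ 20000 * X * X := by gcongr; norm_num
        _ ≤ Δ := hX3.trans hΔ
    exact_mod_cast h1
  have hRΔ : R ≤ Δ := by
    have h1 : (R : ℝ) ≤ (R : ℝ) ^ 2 := by
      exact_mod_cast Nat.le_self_pow (by norm_num) R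
    have h2 : (R : ℝ) ≤ Δ := by linarith
    exact_mod_cast h2
  have hΔ1 : 1 ≤ Δ := by
    have : (1 : ℝ) ≤ Δ := by linarith
    exact_mod_cast this
  have h := le_of_succeedsOn_instance μ hε (by linarith) hD (by omega) hkG hr3 (by omega)
    (by omega) (by
      calc ε * r ≤ ε * (q / 20000) := by gcongr
        _ = 1 / 20000 := by rw [← mul_div_assoc, hεq])
    hR1 hR2 hlen hΔL hRΔ hΔ1 A hA
  refine le_trans ?_ h
  -- The product of the constants is `240000`, and `0.04 / 240000` exceeds `1 / 10000000`.
  have h1 : X ≤ 2 * D * (3 * G) * (40000 * r) := by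
    rw [hXq]
    gcongr
  have h2 : (0 : ℝ) ≤ r * (G * D) := by positivity
  linarith

/-- The space lower bound for large `ε`. -/
lemma le_of_succeedsOn_of_lt {Ω : Type*} [MeasurableSpace Ω] (μ : Measure Ω)
    [IsProbabilityMeasure μ] {d k s n Δ : ℕ} {ε : ℝ} (hε : 1 / 20000 < ε) (hε1 : ε < 1)
    (hk : 2 ≤ k) (hd : 1 / ε ≤ (d : ℝ)) (hn : 20 * (k / ε) ≤ (n : ℝ))
    (hΔ : ((d : ℝ) * k / ε) ^ 3 ≤ (Δ : ℝ)) (A : RowArrivalAlgorithm Ω d k s)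
    (hA : ∀ stream : List (EuclideanSpace ℝ (Fin d)), stream.length ≤ n →
      HasIntegerEntries Δ stream → A.SucceedsOn μ ε stream) :
    1 / 10000000 * ((d : ℝ) * k / ε) ≤ s := by
  have hε0 : 0 < ε := by linarith
  have hk' : (2 : ℝ) ≤ k := by exact_mod_cast hk
  have hd1 : 2 ≤ d := by
    have h1 : (1 : ℝ) < d := lt_of_lt_of_le ((one_lt_div hε0).2 hε1) hd
    exact_mod_cast h1
  have hd' : (2 : ℝ) ≤ d := by exact_mod_cast hd1
  have hkε : (k : ℝ) ≤ k / ε := by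
    rw [le_div_iff₀ hε0]
    nlinarith
  have hX : (k : ℝ) ≤ (d : ℝ) * k / ε := by
    rw [mul_div_assoc]
    nlinarith
  have hX3 : (d : ℝ) * k / ε ≤ ((d : ℝ) * k / ε) ^ 3 := le_self_pow₀ (by linarith) (by norm_num)
  obtain ⟨D, rfl⟩ : ∃ D, d = D + 1 := ⟨d - 1, by omega⟩
  have h := le_of_succeedsOn_bitPoints μ hε0 (by omega) rfl
    (by exact_mod_cast (by linarith : (k : ℝ) ≤ n))
    (by exact_mod_cast hX.trans (hX3.trans hΔ)) A hA
  have h1 : ((D + 1 : ℕ) : ℝ) * k / ε ≤ 20000 * (((D + 1 : ℕ) : ℝ) * k) := by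
    rw [div_le_iff₀ hε0]
    have : 0 ≤ ((D + 1 : ℕ) : ℝ) * k := by positivity
    nlinarith
  push_cast at h1 hd' ⊢
  nlinarith

end LowerBound

end KMeansStream
end

theorem mainTheorem11 :
    ∃ (c C : ℝ) (a b : ℕ), 0 < c ∧ 0 < C ∧
      ∀ (ε : ℝ) (k d n Δ s : ℕ), 0 < ε → ε < 1 → 2 ≤ k → 1 / ε ≤ (d : ℝ) →
        C * (k / ε) ≤ (n : ℝ) → ((d : ℝ) * k / ε) ^ b ≤ (Δ : ℝ) →
        ∀ {Ω : Type*} [MeasurableSpace Ω] (μ : Measure Ω) [IsProbabilityMeasure μ]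
          (A : KMeansStream.RowArrivalAlgorithm Ω d k s),
          (∀ stream : List (EuclideanSpace ℝ (Fin d)),
            stream.length ≤ n → KMeansStream.HasIntegerEntries Δ stream →
            A.SucceedsOn μ ε stream) →
          c * ((d : ℝ) * k / ε) / (Real.log ((d : ℝ) * k / ε)) ^ a ≤ (s : ℝ) := by
  -- The exponent `a = 0` means that no logarithm is lost. The `200000 r` anchors per group account
  -- for most of `C = 20`, and the spacing `L` times the number of offsets, at most `536 X²` for `X
  -- = dk/ε`, fits below `X ^ 3`.
  refine ⟨1 / 10000000, 20, 0, 3, by norm_num, by norm_num, ?_⟩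
  intro ε k d n Δ s hε hε1 hk hd hn hΔ Ω _ μ _ A hA
  rw [pow_zero, div_one]
  rcases le_or_gt ε (1 / 20000) with h | h
  · exact KMeansStream.le_of_succeedsOn_of_le μ hε h hk hd hn hΔ A hA
  · exact KMeansStream.le_of_succeedsOn_of_lt μ h hε1 hk hd hn hΔ A hA
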